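/- Let $R$ be the root system of type $E_7$, with simple roots $\alpha_1,\dots,\alpha_7$ labelled as in Bourbaki, highest root $\tilde\alpha=2\alpha_1+2\alpha_2+3\alpha_3+4\alpha_4+3\alpha_5+2\alpha_6+\alpha_7$ and Weyl group $W$ generated by the simple reflections $s_1,\dots,s_7$. Consider the root datum with $X^*=Q(R)$ (the root lattice) and $X_*=P(R^\vee)$ (the coweight lattice), put $V=X_*\otimes\mathbb{R}$, and let $\rho_1,\dots,\rho_7\in X_*$ be the basis of $V$ dual to $\alpha_1,\dots,\alpha_7$. Let $W_a=Q(R^\vee)\rtimes W$ be the affine Weyl group and $\widetilde W=X_*\rtimes W$ the extended affine Weyl group, both acting on $V$ by affine maps, and write $t_\nu$ for the translation by $\nu\in X_*$. Let $\mathfrak A=\{v\in V : \langle\alpha_i,v\rangle>0 \text{ for } i=1,\dots,7,\ \langle\tilde\alpha,v\rangle<1\}$ be the base alcove and $\Omega$ its stabilizer in $\widetilde W$, so that every element of $\widetilde W$ can be written uniquely as $y\omega$ with $y\in W_a$, $\omega\in\Omega$. The Bruhat order on $W_a$ (with respect to the reflections in the walls of $\mathfrak A$) is extended to $\widetilde W$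 by: $y\omega\le y'\omega'$ if and only if $\omega=\omega'$ and $y\le y'$. For $\mu\in X_*$ let $\operatorname{Adm}(\mu)$ (the $\mu$-admissible elements) be the set of $x\in\widetilde W$ with $x\le t_{w(\mu)}$ for some $w\in W$, and let $\operatorname{Perm}(\mu)$ (the $\mu$-permissible elements) be the set of $x\in\widetilde W$ such that $x$ and $t_\mu$ have the same $\Omega$-component and $x(v)-v$ lies in the convex hull of the orbit $W\mu$ for every $v\in\overline{\mathfrak A}$. A coweight $\mu\in X_*$ is minuscule if $\langle\alpha,\mu\rangle\in\{-1,0,1\}$ for all $\alpha\in R$, dominant if $\langle\alpha_i,\mu\rangle\ge 0$ for all $i$, and nontrivial if $\mu\neq 0$. Then: 1. $\rho_7$ is the unique nontrivial dominant minuscule coweight of $E_7$. 2. Let $\mu=\rho_7$, $w_1=s_2s_4s_5s_3s_4s_1s_3s_2s_4s_5s_6s_7$, $w_2=s_4s_3s_2s_4s_1s_3$, and $x=w_2\,t_\mu\,w_1^{-1}\in\widetilde W$. Then $x\in\operatorname{Perm}(\mu)$ and $x\notin\operatorname{Adm}(\mu)$. 3. $\operatorname{Adm}(\mu)\neq\operatorname{Perm}(\mu)$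 for every nontrivial minuscule coweight $\mu\in P(R^\vee)$ of $E_7$. -/

import Mathlib

open scoped Matrix

/-! ### The Bruhat order of a Coxeter group, given by its set `S` of simple reflections -/

namespace Coxeter

/-- Length of `g` with respect to a set `S` of involutions generating a group:
the least length of a word in `S` with product `g`. -/
noncomputable def length {G : Type*} [Group G] (S : Set G) (g : G) : ℕ :=
  sInf {n : ℕ | ∃ l : List G, (∀ s ∈ l, s ∈ S) ∧ l.prod = g ∧ l.length = n}

/-- Reflections: the conjugates of the simple reflections in the group generated by `S`. -/
def IsReflection {G : Type*} [Group G] (S : Set G) (t : G) : Prop :=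
  ∃ g ∈ Subgroup.closure S, ∃ s ∈ S, t = g * s * g⁻¹

/-- The (strong) Bruhat order on the group generated by `S`: the reflexive transitive closure of
`a < t a`, where `t` is a reflection and `ℓ(a) < ℓ(t a)`. -/
def BruhatLE {G : Type*} [Group G] (S : Set G) : G → G → Prop :=
  Relation.ReflTransGen fun a b =>
    ∃ t, IsReflection S t ∧ b = t * a ∧ length S a < length S b

end Coxeter

/-! ### Extended affine Weyl groups

Throughout, `P` is a root system in `U`, with coroots in the dual space `V`.  It determines the
root datum `(Q(R), P(R^∨), R, R^∨)`: here `X^* = Q(R)` is the root lattice in `U`, and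
`X_* = P(R^∨)`, the lattice of coweights, is the dual lattice in `V = X_* ⊗ ℝ`.
The family `α` is the chosen base of simple roots, and `θ` is the highest root. -/

namespace AffineWeyl

section

variable {ι κ U V : Type*} [AddCommGroup U] [Module ℝ U] [AddCommGroup V] [Module ℝ V]

/-- The finite Weyl group `W`, acting on `V`; it is generated by the reflections
`v ↦ v - ⟨β, v⟩ β^∨`. -/
def finiteWeyl (P : RootPairing ι ℝ U V) : Subgroup (V ≃ₗ[ℝ] V) :=
  Subgroup.closure (Set.range P.coreflection)

/-- The coweight lattice `P(R^∨)`, which is the group of cocharacters `X_*`. -/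
def coweightLattice (P : RootPairing ι ℝ U V) : AddSubgroup V where
  carrier := {v | ∀ i, ∃ n : ℤ, P.root' i v = n}
  zero_mem' i := ⟨0, by simp⟩
  add_mem' {v w} hv hw i := by
    obtain ⟨m, hm⟩ := hv i
    obtain ⟨n, hn⟩ := hw i
    exact ⟨m + n, by rw [map_add, hm, hn]; push_cast; rfl⟩
  neg_mem' {v} hv i := by
    obtain ⟨m, hm⟩ := hv i
    exact ⟨-m, by rw [map_neg, hm]; push_cast; rfl⟩

/-- The coroot lattice `Q(R^∨)`. -/
def corootLattice (P : RootPairing ι ℝ U V) : AddSubgroup V :=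
  AddSubgroup.closure (Set.range P.coroot)

theorem finiteWeyl_stable (P : RootPairing ι ℝ U V) (L : AddSubgroup V)
    (h : ∀ i, ∀ v ∈ L, P.coreflection i v ∈ L) :
    ∀ w ∈ finiteWeyl P, ∀ v ∈ L, w v ∈ L := by
  intro w hw
  induction hw using Subgroup.closure_induction'' with
  | one => exact fun v hv => hv
  | mem x hx =>
    obtain ⟨i, rfl⟩ := hx
    exact h i
  | inv_mem x hx =>
    obtain ⟨i, rfl⟩ := hx
    rw [P.coreflection_inv]
    exact h i
  | mul x y _ _ hx hy => exact fun v hv => hx _ (hy v hv)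

theorem coweightLattice_stable (P : RootPairing ι ℝ U V) :
    ∀ w ∈ finiteWeyl P, ∀ v ∈ coweightLattice P, w v ∈ coweightLattice P := by
  refine finiteWeyl_stable P _ fun i v hv j => ?_
  obtain ⟨n, hn⟩ := hv (P.reflectionPerm i j)
  refine ⟨n, hn ▸ ?_⟩
  simp [RootPairing.root', RootPairing.root_reflectionPerm, RootPairing.reflection_apply,
    RootPairing.coreflection_apply, mul_comm]

theorem corootLattice_stable (P : RootPairing ι ℝ U V) :
    ∀ w ∈ finiteWeyl P, ∀ v ∈ corootLattice P, w v ∈ corootLattice P := by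
  refine finiteWeyl_stable P _ fun i v hv => ?_
  induction hv using AddSubgroup.closure_induction with
  | mem x hx =>
    obtain ⟨j, rfl⟩ := hx
    rw [← P.coroot_reflectionPerm]
    exact AddSubgroup.subset_closure ⟨_, rfl⟩
  | zero => simp
  | add x y _ _ hx hy => simpa using AddSubgroup.add_mem _ hx hy
  | neg x _ hx => simpa using AddSubgroup.neg_mem _ hx

/-- The group `L ⋊ W` of all affine maps `v ↦ w v + ν` with `w ∈ W` and `ν ∈ L`, where `L` is a
lattice in `V` stable under `W`. -/
def semidirect (P : RootPairing ι ℝ U V) (L : AddSubgroup V)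
    (hL : ∀ w ∈ finiteWeyl P, ∀ v ∈ L, w v ∈ L) : Subgroup (V ≃ᵃ[ℝ] V) where
  carrier := {x | x.linear ∈ finiteWeyl P ∧ x 0 ∈ L}
  one_mem' := ⟨(finiteWeyl P).one_mem, L.zero_mem⟩
  mul_mem' {x y} hx hy := by
    refine ⟨(finiteWeyl P).mul_mem hx.1 hy.1, ?_⟩
    have h : (x * y) 0 = x.linear (y 0) + x 0 := by
      have := x.map_vadd 0 (y 0)
      simpa using this
    rw [h]
    exact L.add_mem (hL _ hx.1 _ hy.2) hx.2
  inv_mem' {x} hx := by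
    have h1 : (x⁻¹).linear ∈ finiteWeyl P := (finiteWeyl P).inv_mem hx.1
    refine ⟨h1, ?_⟩
    have h : x⁻¹ 0 = - (x⁻¹).linear (x 0) := by
      have h2 := (x⁻¹).map_vadd 0 (x 0)
      have h3 : x⁻¹ (x 0) = 0 := x.symm_apply_apply 0
      simp only [vadd_eq_add, add_zero, h3] at h2
      exact (neg_eq_of_add_eq_zero_right h2.symm).symm
    rw [h]
    exact L.neg_mem (hL _ h1 _ hx.2)

/-- The affine Weyl group `W_a = Q(R^∨) ⋊ W`. -/
def affineWeyl (P : RootPairing ι ℝ U V) : Subgroup (V ≃ᵃ[ℝ] V) :=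
  semidirect P (corootLattice P) (corootLattice_stable P)

/-- The extended affine Weyl group `X_* ⋊ W = P(R^∨) ⋊ W`. -/
def extAffineWeyl (P : RootPairing ι ℝ U V) : Subgroup (V ≃ᵃ[ℝ] V) :=
  semidirect P (coweightLattice P) (coweightLattice_stable P)

/-- The translation `t_ν : v ↦ v + ν`. -/
def trans (ν : V) : V ≃ᵃ[ℝ] V := AffineEquiv.constVAdd ℝ V ν

/-- The linear reflection `s_β`, as an affine map. -/
def refl (P : RootPairing ι ℝ U V) (i : ι) : V ≃ᵃ[ℝ] V := (P.coreflection i).toAffineEquiv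

/-- The simple affine reflections, that is, the reflections in the walls of the base alcove:
`s_i` for the simple roots, and `s_0 = t_{θ^∨} s_θ`, which is `v ↦ v - (⟨θ, v⟩ - 1) θ^∨`. -/
def simpleAffine (P : RootPairing ι ℝ U V) (α : κ → ι) (θ : ι) : Set (V ≃ᵃ[ℝ] V) :=
  Set.range (fun k => refl P (α k)) ∪ {trans (P.coroot θ) * refl P θ}

/-- The base alcove. -/
def alcove (P : RootPairing ι ℝ U V) (α : κ → ι) (θ : ι) : Set V :=
  {v | (∀ k, 0 < P.root' (α k) v) ∧ P.root' θ v < 1}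

/-- The stabilizer `Ω` of the base alcove in the extended affine Weyl group. -/
def Omega (P : RootPairing ι ℝ U V) (α : κ → ι) (θ : ι) : Set (V ≃ᵃ[ℝ] V) :=
  {x | x ∈ extAffineWeyl P ∧ x '' alcove P α θ = alcove P α θ}

/-- The Bruhat order on the extended affine Weyl group: `y ω ≤ y' ω'` if and only if `ω = ω'` and
`y ≤ y'` in `W_a`, for `y, y' ∈ W_a` and `ω, ω' ∈ Ω`. -/
def ExtBruhatLE (P : RootPairing ι ℝ U V) (α : κ → ι) (θ : ι) (x x' : V ≃ᵃ[ℝ] V) : Prop :=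
  ∃ ω ∈ Omega P α θ, ∃ y ∈ affineWeyl P, ∃ y' ∈ affineWeyl P,
    x = y * ω ∧ x' = y' * ω ∧ Coxeter.BruhatLE (simpleAffine P α θ) y y'

/-- The orbit `W μ`. -/
def orbit (P : RootPairing ι ℝ U V) (μ : V) : Set V := {v | ∃ w ∈ finiteWeyl P, v = w μ}

/-- The `μ`-admissible set. -/
def Adm (P : RootPairing ι ℝ U V) (α : κ → ι) (θ : ι) (μ : V) : Set (V ≃ᵃ[ℝ] V) :=
  {x | x ∈ extAffineWeyl P ∧ ∃ w ∈ finiteWeyl P, ExtBruhatLE P α θ x (trans (w μ))}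

/-- The `μ`-permissible set: `x` and `t_μ` have the same component in `Ω` (with respect to the
decomposition of the extended affine Weyl group as `W_a Ω`), and `x v - v` lies in the convex hull
of `W μ` for all `v` in the closed base alcove. -/
def Perm [TopologicalSpace V] (P : RootPairing ι ℝ U V) (α : κ → ι) (θ : ι) (μ : V) :
    Set (V ≃ᵃ[ℝ] V) :=
  {x | x ∈ extAffineWeyl P ∧
    (∃ ω ∈ Omega P α θ, ∃ y₁ ∈ affineWeyl P, ∃ y₂ ∈ affineWeyl P,
      x = y₁ * ω ∧ trans μ = y₂ * ω) ∧
    ∀ v ∈ closure (alcove P α θ), x v - v ∈ convexHull ℝ (orbit P μ)}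

def IsMinuscule (P : RootPairing ι ℝ U V) (μ : V) : Prop :=
  ∀ i, P.root' i μ = -1 ∨ P.root' i μ = 0 ∨ P.root' i μ = 1

def IsDominant (P : RootPairing ι ℝ U V) (α : κ → ι) (μ : V) : Prop :=
  ∀ k, 0 ≤ P.root' (α k) μ

end

end AffineWeyl

/-! ### The root system `E₇`

`U = ℝ⁷` has the basis of simple roots `α₁, …, α₇` (labelled as in Bourbaki), and `V = ℝ⁷` has the
dual basis of fundamental coweights `ρ₁, …, ρ₇`; the pairing is the dot product.  The roots are the
vectors obtained from the simple roots by repeatedly applying simple reflections.  In type `E₇` the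
coroot of `r = ∑ cⱼ αⱼ` is `∑ cⱼ αⱼ^∨`, and `αⱼ^∨ = ∑ᵢ ⟨αᵢ, αⱼ^∨⟩ ρᵢ` is given by the `j`-th column
of the Cartan matrix.  All indices are shifted by one: `αᵢ` has the index `i - 1` in `Fin 7`. -/

namespace E7

/-- `⟨x, r^∨⟩` for `x` and `r` in the root lattice, in coordinates with respect to the simple
roots. -/
def form (x r : Fin 7 → ℤ) : ℤ := x ⬝ᵥ (CartanMatrix.E₇ *ᵥ r)

/-- The reflection `x ↦ x - ⟨x, r^∨⟩ r` on the root lattice. -/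
def reflect (r x : Fin 7 → ℤ) : Fin 7 → ℤ := x - form x r • r

/-- The roots, in coordinates with respect to the simple roots. -/
inductive IsRoot : (Fin 7 → ℤ) → Prop
  | simple (i : Fin 7) : IsRoot (Pi.single i 1)
  | reflect (i : Fin 7) (r : Fin 7 → ℤ) : IsRoot r → IsRoot (reflect (Pi.single i 1) r)

theorem form_comm (x y : Fin 7 → ℤ) : form x y = form y x := by
  rw [form, form, Matrix.dotProduct_mulVec, ← Matrix.mulVec_transpose, CartanMatrix.E₇_transpose,
    dotProduct_comm]

theorem form_sub_left (x y z : Fin 7 → ℤ) : form (x - y) z = form x z - form y z := by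
  simp [form, sub_dotProduct]

theorem form_smul_left (c : ℤ) (x z : Fin 7 → ℤ) : form (c • x) z = c * form x z := by
  rw [form, form, smul_dotProduct, smul_eq_mul]

theorem form_sub_right (x y z : Fin 7 → ℤ) : form x (y - z) = form x y - form x z := by
  rw [form_comm, form_sub_left, form_comm y, form_comm z]

theorem form_smul_right (c : ℤ) (x z : Fin 7 → ℤ) : form x (c • z) = c * form x z := by
  rw [form_comm, form_smul_left, form_comm]

theorem form_single (i : Fin 7) : form (Pi.single i 1) (Pi.single i 1) = 2 := by
  simp [form]

theorem form_reflect (r x y : Fin 7 → ℤ) (h : form r r = 2) :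
    form (reflect r x) (reflect r y) = form x y := by
  simp only [reflect, form_sub_left, form_sub_right, form_smul_left, form_smul_right, h,
    form_comm r y]
  ring

theorem reflect_reflect (r x : Fin 7 → ℤ) (h : form r r = 2) : reflect r (reflect r x) = x := by
  simp only [reflect, form_sub_left, form_smul_left, h]
  module

theorem IsRoot.form_self {r : Fin 7 → ℤ} (h : IsRoot r) : form r r = 2 := by
  induction h with
  | simple i => exact form_single i
  | reflect i r _ ih => rw [form_reflect _ _ _ (form_single i), ih]

theorem IsRoot.reflect_mem {r : Fin 7 → ℤ} (hr : IsRoot r) :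
    ∀ x, IsRoot x → IsRoot (E7.reflect r x) := by
  induction hr with
  | simple i => exact fun x hx => .reflect i x hx
  | reflect i r _ ih =>
    intro x hx
    have hi := form_single i
    have key : E7.reflect (E7.reflect (Pi.single i 1) r) x =
        E7.reflect (Pi.single i 1) (E7.reflect r (E7.reflect (Pi.single i 1) x)) := by
      have h1 : form x (E7.reflect (Pi.single i 1) r) =
          form (E7.reflect (Pi.single i 1) x) r := by
        rw [← form_reflect _ _ _ hi, reflect_reflect _ _ hi]
      rw [show E7.reflect (E7.reflect (Pi.single i 1) r) x = x -
        form x (E7.reflect (Pi.single i 1) r) • E7.reflect (Pi.single i 1) r from rfl, h1,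
        show E7.reflect r (E7.reflect (Pi.single i 1) x) = E7.reflect (Pi.single i 1) x -
          form (E7.reflect (Pi.single i 1) x) r • r from rfl]
      generalize form (E7.reflect (Pi.single i 1) x) r = c
      have h2 := reflect_reflect _ x hi
      rw [show E7.reflect (Pi.single i 1) (E7.reflect (Pi.single i 1) x - c • r) =
        E7.reflect (Pi.single i 1) (E7.reflect (Pi.single i 1) x) -
          c • E7.reflect (Pi.single i 1) r by
        simp only [E7.reflect, form_sub_left, form_smul_left]; module, h2]
    rw [key]
    exact .reflect i _ (ih _ (.reflect i x hx))

/-- The index type of the set of roots. -/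
abbrev Root : Type := {r : Fin 7 → ℤ // IsRoot r}

instance dotProduct_isPerfPair :
    (dotProductBilin ℝ ℝ : (Fin 7 → ℝ) →ₗ[ℝ] (Fin 7 → ℝ) →ₗ[ℝ] ℝ).IsPerfPair := by
  refine .of_injective ?_ ?_
  · intro x y h
    exact dotProduct_eq _ _ fun u => LinearMap.congr_fun h u
  · intro x y h
    refine dotProduct_eq _ _ fun u => ?_
    rw [dotProduct_comm x, dotProduct_comm y]
    exact LinearMap.congr_fun h u

theorem cast_dotProduct (x r : Fin 7 → ℤ) :
    (fun j => (x j : ℝ)) ⬝ᵥ (fun j => ((CartanMatrix.E₇ *ᵥ r) j : ℝ)) = (form x r : ℝ) := by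
  simp [form, dotProduct]

/-- The root system `E₇`. -/
noncomputable def rootSystem : RootPairing Root ℝ (Fin 7 → ℝ) (Fin 7 → ℝ) where
  toLinearMap := dotProductBilin ℝ ℝ
  root := ⟨fun r j => (r.1 j : ℝ), fun r s h => Subtype.ext <| funext fun j => by
    simpa using congrFun h j⟩
  coroot := ⟨fun r j => ((CartanMatrix.E₇ *ᵥ r.1) j : ℝ), fun r s h => Subtype.ext <| by
    have h1 : CartanMatrix.E₇ *ᵥ r.1 = CartanMatrix.E₇ *ᵥ s.1 := funext fun j => by
      simpa using congrFun h j
    refine Matrix.mulVec_injective_of_det_ne_zero ?_ h1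
    rw [CartanMatrix.E₇_det]; norm_num⟩
  root_coroot_two r := by
    refine (cast_dotProduct r.1 r.1).trans ?_
    rw [r.2.form_self]; norm_num
  reflectionPerm r :=
    { toFun := fun x => ⟨reflect r.1 x.1, r.2.reflect_mem _ x.2⟩
      invFun := fun x => ⟨reflect r.1 x.1, r.2.reflect_mem _ x.2⟩
      left_inv := fun x => Subtype.ext (reflect_reflect _ _ r.2.form_self)
      right_inv := fun x => Subtype.ext (reflect_reflect _ _ r.2.form_self) }
  reflectionPerm_root r x := by
    have h : (dotProductBilin ℝ ℝ) (fun j => (x.1 j : ℝ))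
      (fun j => ((CartanMatrix.E₇ *ᵥ r.1) j : ℝ)) = (form x.1 r.1 : ℝ) := cast_dotProduct x.1 r.1
    change (fun j => (x.1 j : ℝ)) - _ • (fun j => (r.1 j : ℝ)) = fun j => (reflect r.1 x.1 j : ℝ)
    erw [h]
    funext j
    simp [reflect]
  reflectionPerm_coroot r x := by
    have h : (dotProductBilin ℝ ℝ) (fun j => (r.1 j : ℝ))
      (fun j => ((CartanMatrix.E₇ *ᵥ x.1) j : ℝ)) = (form x.1 r.1 : ℝ) := by
      rw [form_comm]; exact cast_dotProduct r.1 x.1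
    change (fun j => ((CartanMatrix.E₇ *ᵥ x.1) j : ℝ)) - _ •
      (fun j => ((CartanMatrix.E₇ *ᵥ r.1) j : ℝ)) =
      fun j => ((CartanMatrix.E₇ *ᵥ (reflect r.1 x.1)) j : ℝ)
    erw [h]
    funext j
    rw [reflect, Matrix.mulVec_sub, Matrix.mulVec_smul]
    simp only [Pi.sub_apply, Pi.smul_apply, smul_eq_mul, Int.cast_sub, Int.cast_mul]

/-- The base of simple roots. -/
def simpleRoot (i : Fin 7) : Root := ⟨Pi.single i 1, .simple i⟩

theorem isRoot_highest : IsRoot ![2, 2, 3, 4, 3, 2, 1] := by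
  have h := IsRoot.simple 0
  have h := h.reflect 2
  have h := h.reflect 3
  have h := h.reflect 1
  have h := h.reflect 4
  have h := h.reflect 3
  have h := h.reflect 2
  have h := h.reflect 5
  have h := h.reflect 4
  have h := h.reflect 3
  have h := h.reflect 1
  have h := h.reflect 6
  have h := h.reflect 5
  have h := h.reflect 4
  have h := h.reflect 3
  have h := h.reflect 2
  have h := h.reflect 0
  convert h using 1
  decide

/-- The highest root `2α₁ + 2α₂ + 3α₃ + 4α₄ + 3α₅ + 2α₆ + α₇`. -/
def highestRoot : Root := ⟨![2, 2, 3, 4, 3, 2, 1], isRoot_highest⟩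

/-- The fundamental coweight `ρ₇`. -/
def rho7 : Fin 7 → ℝ := Pi.single 6 1

/-- The simple reflection `s_i`, for `i = 1, …, 7`. -/
noncomputable def s (i : ℕ) : (Fin 7 → ℝ) ≃ᵃ[ℝ] (Fin 7 → ℝ) :=
  AffineWeyl.refl rootSystem (simpleRoot (Fin.ofNat 7 (i - 1)))

noncomputable def w₁ : (Fin 7 → ℝ) ≃ᵃ[ℝ] (Fin 7 → ℝ) :=
  s 2 * s 4 * s 5 * s 3 * s 4 * s 1 * s 3 * s 2 * s 4 * s 5 * s 6 * s 7

noncomputable def w₂ : (Fin 7 → ℝ) ≃ᵃ[ℝ] (Fin 7 → ℝ) :=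
  s 4 * s 3 * s 2 * s 4 * s 1 * s 3

/-- The element `x = w₂ t_μ w₁⁻¹` for `μ = ρ₇`. -/
noncomputable def x : (Fin 7 → ℝ) ≃ᵃ[ℝ] (Fin 7 → ℝ) := w₂ * AffineWeyl.trans rho7 * w₁⁻¹

/-- The set `Adm(μ)` for the root datum `(Q(R), P(R^∨))` with `R = E₇`. -/
def Adm (μ : Fin 7 → ℝ) : Set ((Fin 7 → ℝ) ≃ᵃ[ℝ] (Fin 7 → ℝ)) :=
  AffineWeyl.Adm rootSystem simpleRoot highestRoot μ

/-- The set `Perm(μ)` for the root datum `(Q(R), P(R^∨))` with `R = E₇`. -/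
def Perm (μ : Fin 7 → ℝ) : Set ((Fin 7 → ℝ) ≃ᵃ[ℝ] (Fin 7 → ℝ)) :=
  AffineWeyl.Perm rootSystem simpleRoot highestRoot μ

end E7

/-!
On the closed base alcove `x v - v` is an explicit convex combination of eight points of the orbit
of `ρ₇`, so that `x` is permissible. On the other hand, translation by a minuscule coweight moves a
small regular point `v₀` of the base alcove to a point whose difference with `v₀` has all its root
values in `[-1, 1]`, and this property passes down the Bruhat order. Hence if `a t_μ b⁻¹ ≤ t_ν` for
minuscule `μ` and `ν` and `a`, `b` in the finite Weyl group, with `μ` in the chamber of `v₀`, each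
step of a chain of reflections from `a t_μ b⁻¹` to `t_ν` either raises `a` or lowers `b`; as `a = b`
at the top, `a ≤ b`. For `x` this would give `w₂ ≤ w₁`, which fails by the lifting property along a
reduced word of `w₁`. Every nontrivial minuscule coweight is in the orbit of `ρ₇`, and `Adm` and
`Perm` depend only on the orbit.
-/

namespace Coxeter

variable {G : Type*} [Group G] {S : Set G}

theorem exists_word_of_mem_closure (hS : ∀ s ∈ S, s⁻¹ = s) {g : G}
    (hg : g ∈ Subgroup.closure S) : ∃ l : List G, (∀ s ∈ l, s ∈ S) ∧ l.prod = g := by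
  rw [← Subgroup.mem_toSubmonoid, Subgroup.closure_toSubmonoid] at hg
  obtain ⟨l, hl, rfl⟩ := Submonoid.exists_list_of_mem_closure hg
  exact ⟨l, fun s hs => (hl s hs).elim id fun h => ((inv_inv s).symm.trans (hS _ h)).symm ▸ h, rfl⟩

theorem length_prod_le {l : List G} (hl : ∀ s ∈ l, s ∈ S) : length S l.prod ≤ l.length :=
  Nat.sInf_le ⟨l, hl, rfl, rfl⟩

theorem exists_reduced_word (hS : ∀ s ∈ S, s⁻¹ = s) {g : G} (hg : g ∈ Subgroup.closure S) :
    ∃ l : List G, (∀ s ∈ l, s ∈ S) ∧ l.prod = g ∧ l.length = length S g := by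
  obtain ⟨l, hl, hlg⟩ := exists_word_of_mem_closure hS hg
  exact Nat.sInf_mem (s := {n | ∃ l : List G, (∀ s ∈ l, s ∈ S) ∧ l.prod = g ∧ l.length = n})
    ⟨l.length, l, hl, hlg, rfl⟩

/-- Outside the subgroup generated by `S` the length is the infimum of the empty set, hence `0`. -/
theorem mem_closure_of_length_pos {g : G} (h : 0 < length S g) : g ∈ Subgroup.closure S := by
  obtain ⟨_, l, hl, rfl, -⟩ := Nat.nonempty_of_pos_sInf h
  exact list_prod_mem fun s hs => Subgroup.subset_closure (hl s hs)

theorem IsReflection.mem_closure {t : G} (ht : IsReflection S t) : t ∈ Subgroup.closure S := by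
  obtain ⟨g, hg, s, hs, rfl⟩ := ht
  exact mul_mem (mul_mem hg (Subgroup.subset_closure hs)) (inv_mem hg)

end Coxeter

namespace AffineWeyl

variable {ι κ U V : Type*} [AddCommGroup U] [Module ℝ U] [AddCommGroup V] [Module ℝ V]
  (P : RootPairing ι ℝ U V)

/-! ### Affine roots and affine reflections -/

/-- The affine root `⟨β, ·⟩ - k`, for the root `β` of index `i`; its zero set is a wall. -/
def affineRoot (i : ι) (k : ℤ) (v : V) : ℝ := P.root' i v - k

/-- The reflection `v ↦ v - (⟨β, v⟩ - k) β^∨` in the zero set of `affineRoot P i k`. -/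
def affRefl (i : ι) (k : ℤ) : V ≃ᵃ[ℝ] V := trans ((k : ℝ) • P.coroot i) * refl P i

/-- `u` and `v` lie strictly on the same side of the zero set of `affineRoot P i k`. -/
def SameSide (i : ι) (k : ℤ) (u v : V) : Prop := 0 < affineRoot P i k u * affineRoot P i k v

variable {P}

theorem mul_apply (g h : V ≃ᵃ[ℝ] V) (v : V) : (g * h) v = g (h v) := rfl

theorem trans_apply (ν v : V) : trans ν v = ν + v := rfl

theorem refl_apply (i : ι) (v : V) : refl P i v = v - P.root' i v • P.coroot i :=
  P.coreflection_apply i v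

theorem affRefl_apply (i : ι) (k : ℤ) (v : V) :
    affRefl P i k v = v - affineRoot P i k v • P.coroot i := by
  rw [affRefl, mul_apply, trans_apply, refl_apply, affineRoot]
  module

theorem affRefl_zero (i : ι) : affRefl P i 0 = refl P i := by
  ext v
  rw [affRefl_apply, refl_apply, affineRoot, Int.cast_zero, sub_zero]

theorem affRefl_one (i : ι) : affRefl P i 1 = trans (P.coroot i) * refl P i := by
  rw [affRefl, Int.cast_one, one_smul]

theorem affineRoot_affRefl (i : ι) (k : ℤ) (v : V) :
    affineRoot P i k (affRefl P i k v) = -affineRoot P i k v := by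
  rw [affRefl_apply, affineRoot, map_sub, map_smul, P.root'_coroot_eq_pairing, P.pairing_same,
    affineRoot, smul_eq_mul]
  ring

theorem affRefl_mul_self (i : ι) (k : ℤ) : affRefl P i k * affRefl P i k = 1 := by
  ext v
  rw [mul_apply, affRefl_apply _ _ (affRefl P i k v), affineRoot_affRefl, affRefl_apply]
  simp

theorem affRefl_inv (i : ι) (k : ℤ) : (affRefl P i k)⁻¹ = affRefl P i k :=
  inv_eq_of_mul_eq_one_left (affRefl_mul_self i k)

theorem affineRoot_of_root_eq_neg {i j : ι} (h : P.root i = -P.root j) (k : ℤ) (v : V) :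
    affineRoot P i k v = -affineRoot P j (-k) v := by
  simp only [affineRoot, RootPairing.root', h, map_neg, LinearMap.neg_apply, Int.cast_neg]
  ring

theorem affRefl_of_root_eq_neg {i j : ι} (h : P.root i = -P.root j) (k : ℤ) :
    affRefl P i k = affRefl P j (-k) := by
  have hj : i = P.reflectionPerm j j := P.root.injective <| by
    rw [h, P.root_reflectionPerm, P.reflection_apply_self]
  have hcoroot : P.coroot i = -P.coroot j := by
    rw [hj, P.coroot_reflectionPerm, P.coreflection_apply_self]
  ext v
  rw [affRefl_apply, affRefl_apply, affineRoot_of_root_eq_neg h, hcoroot, neg_smul_neg]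

theorem SameSide.symm {i : ι} {k : ℤ} {u v : V} (h : SameSide P i k u v) : SameSide P i k v u := by
  rwa [SameSide, mul_comm]

theorem SameSide.trans {i : ι} {k : ℤ} {u v w : V} (huv : SameSide P i k u v)
    (hvw : SameSide P i k v w) : SameSide P i k u w := by
  have h := mul_pos huv hvw
  rw [show affineRoot P i k u * affineRoot P i k v * (affineRoot P i k v * affineRoot P i k w) =
    affineRoot P i k u * affineRoot P i k w * affineRoot P i k v ^ 2 by ring] at h
  exact pos_of_mul_pos_left h (sq_nonneg _)

theorem sameSide_map_iff {i j : ι} {k l : ℤ} {g : V ≃ᵃ[ℝ] V}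
    (hg : ∀ v, affineRoot P i k (g v) = affineRoot P j l v) {u v : V} :
    SameSide P i k (g u) (g v) ↔ SameSide P j l u v := by
  rw [SameSide, hg, hg, SameSide]

theorem not_sameSide_affRefl {i : ι} {k : ℤ} {u v : V} (h : SameSide P i k u v) :
    ¬ SameSide P i k u (affRefl P i k v) := by
  unfold SameSide at *
  rw [affineRoot_affRefl]
  linarith

/-! ### The action of the extended affine Weyl group on affine roots -/

theorem coreflection_mem_finiteWeyl (i : ι) : P.coreflection i ∈ finiteWeyl P :=
  Subgroup.subset_closure ⟨i, rfl⟩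

theorem exists_root_comap_of_mem_finiteWeyl {w : V ≃ₗ[ℝ] V} (hw : w ∈ finiteWeyl P) (i : ι) :
    ∃ j, (∀ v, P.root' i (w v) = P.root' j v) ∧ w (P.coroot j) = P.coroot i := by
  have reflection (k i : ι) : ∃ j, (∀ v, P.root' i (P.coreflection k v) = P.root' j v) ∧
      P.coreflection k (P.coroot j) = P.coroot i := by
    refine ⟨P.reflectionPerm k i, fun v => ?_, ?_⟩
    · simp [RootPairing.root', P.root_reflectionPerm, P.reflection_apply, P.coreflection_apply,
        mul_comm]
    · rw [P.coroot_reflectionPerm, P.coreflection_same]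
  induction hw using Subgroup.closure_induction'' generalizing i with
  | one => exact ⟨i, fun _ => rfl, rfl⟩
  | mem _ h => obtain ⟨k, rfl⟩ := h; exact reflection k i
  | inv_mem _ h => obtain ⟨k, rfl⟩ := h; rw [P.coreflection_inv]; exact reflection k i
  | mul x y _ _ hx hy =>
    obtain ⟨j, hj, hji⟩ := hx i
    obtain ⟨l, hl, hlj⟩ := hy j
    exact ⟨l, fun v => (hj _).trans (hl v), (congrArg x hlj).trans hji⟩

theorem apply_eq_linear_add (g : V ≃ᵃ[ℝ] V) (v : V) : g v = g.linear v + g 0 := by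
  simpa using g.map_vadd 0 v

theorem exists_affineRoot_comap_of_mem_extAffineWeyl {g : V ≃ᵃ[ℝ] V} (hg : g ∈ extAffineWeyl P)
    (i : ι) (k : ℤ) : ∃ j l, (∀ v, affineRoot P i k (g v) = affineRoot P j l v) ∧
      affRefl P i k * g = g * affRefl P j l := by
  obtain ⟨j, hj, hji⟩ := exists_root_comap_of_mem_finiteWeyl hg.1 i
  obtain ⟨n, hn⟩ := hg.2 i
  have comap (v : V) : affineRoot P i k (g v) = affineRoot P j (k - n) v := by
    simp only [affineRoot, apply_eq_linear_add g v, map_add, hn]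
    erw [hj]
    push_cast
    ring
  refine ⟨j, k - n, comap, AffineEquiv.ext fun v => ?_⟩
  rw [mul_apply, mul_apply, affRefl_apply, affRefl_apply, comap, apply_eq_linear_add g,
    apply_eq_linear_add g (v - _), map_sub, map_smul]
  erw [hji]
  abel

theorem refl_mem_extAffineWeyl (i : ι) : refl P i ∈ extAffineWeyl P :=
  ⟨coreflection_mem_finiteWeyl i, by simp [refl]⟩

theorem trans_mem_extAffineWeyl {ν : V} (hν : ν ∈ coweightLattice P) :
    trans ν ∈ extAffineWeyl P :=
  ⟨(finiteWeyl P).one_mem, by simpa [trans] using hν⟩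

theorem coroot_mem_corootLattice (i : ι) : P.coroot i ∈ corootLattice P :=
  AddSubgroup.subset_closure ⟨i, rfl⟩

theorem affRefl_mem_affineWeyl (i : ι) (k : ℤ) : affRefl P i k ∈ affineWeyl P := by
  refine ⟨coreflection_mem_finiteWeyl i, ?_⟩
  have h : affRefl P i k 0 = k • P.coroot i := by
    simp [affRefl_apply, affineRoot, Int.cast_smul_eq_zsmul]
  rw [h]
  exact zsmul_mem (coroot_mem_corootLattice i) k

theorem corootLattice_le_coweightLattice [P.IsCrystallographic] :
    corootLattice P ≤ coweightLattice P := by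
  rw [corootLattice, AddSubgroup.closure_le]
  rintro _ ⟨j, rfl⟩ i
  obtain ⟨n, hn⟩ := P.exists_value (S := ℤ) i j
  exact ⟨n, by rw [P.root'_coroot_eq_pairing, ← hn]; rfl⟩

theorem affineWeyl_le_extAffineWeyl [P.IsCrystallographic] : affineWeyl P ≤ extAffineWeyl P :=
  fun _ hg => ⟨hg.1, corootLattice_le_coweightLattice hg.2⟩

theorem affRefl_mem_extAffineWeyl [P.IsCrystallographic] (i : ι) (k : ℤ) :
    affRefl P i k ∈ extAffineWeyl P :=
  affineWeyl_le_extAffineWeyl (affRefl_mem_affineWeyl i k)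

/-! ### Walls of the base alcove -/

/-- The closed base alcove, described by its defining inequalities. -/
def closedAlcove (P : RootPairing ι ℝ U V) (α : κ → ι) (θ : ι) : Set V :=
  {v | (∀ k, 0 ≤ P.root' (α k) v) ∧ P.root' θ v ≤ 1}

section Alcove

variable {α : κ → ι} {θ : ι}

theorem exists_affRefl_of_mem_simpleAffine {s : V ≃ᵃ[ℝ] V} (hs : s ∈ simpleAffine P α θ) :
    ∃ i k, s = affRefl P i k := by
  rcases hs with ⟨k, rfl⟩ | rfl
  exacts [⟨α k, 0, (affRefl_zero _).symm⟩, ⟨θ, 1, (affRefl_one _).symm⟩]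

theorem inv_of_mem_simpleAffine {s : V ≃ᵃ[ℝ] V} (hs : s ∈ simpleAffine P α θ) : s⁻¹ = s := by
  obtain ⟨i, k, rfl⟩ := exists_affRefl_of_mem_simpleAffine hs
  exact affRefl_inv i k

theorem mul_self_of_mem_simpleAffine {s : V ≃ᵃ[ℝ] V} (hs : s ∈ simpleAffine P α θ) : s * s = 1 := by
  obtain ⟨i, k, rfl⟩ := exists_affRefl_of_mem_simpleAffine hs
  exact affRefl_mul_self i k

theorem mem_extAffineWeyl_of_mem_simpleAffine [P.IsCrystallographic] {s : V ≃ᵃ[ℝ] V}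
    (hs : s ∈ simpleAffine P α θ) : s ∈ extAffineWeyl P := by
  obtain ⟨i, k, rfl⟩ := exists_affRefl_of_mem_simpleAffine hs
  exact affRefl_mem_extAffineWeyl i k

theorem closure_simpleAffine_le [P.IsCrystallographic] :
    Subgroup.closure (simpleAffine P α θ) ≤ extAffineWeyl P :=
  (Subgroup.closure_le _).2 fun _ => mem_extAffineWeyl_of_mem_simpleAffine

theorem exists_affRefl_of_isReflection [P.IsCrystallographic] {t : V ≃ᵃ[ℝ] V}
    (ht : Coxeter.IsReflection (simpleAffine P α θ) t) : ∃ i k, t = affRefl P i k := by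
  obtain ⟨g, hg, s, hs, rfl⟩ := ht
  obtain ⟨i, k, rfl⟩ := exists_affRefl_of_mem_simpleAffine hs
  obtain ⟨j, l, -, hconj⟩ :=
    exists_affineRoot_comap_of_mem_extAffineWeyl (inv_mem (closure_simpleAffine_le hg)) i k
  exact ⟨j, l, by rw [mul_assoc, hconj, mul_inv_cancel_left]⟩

variable [Fintype κ]

/-- `x` lies in the cone spanned by the roots `α k`. -/
def IsConeCombination (P : RootPairing ι ℝ U V) (α : κ → ι) (x : U) : Prop :=
  ∃ c : κ → ℝ, 0 ≤ c ∧ x = ∑ k, c k • P.root (α k)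

/-- The roots `α k` are linearly independent, and for every root `β`, up to sign, both `β` and
`θ - β` are nonnegative combinations of them. This is what the geometry of the base alcove needs to
know about a base of an irreducible root system and its highest root. -/
structure IsBaseWithHighestRoot (P : RootPairing ι ℝ U V) (α : κ → ι) (θ : ι) : Prop where
  linearIndependent : LinearIndependent ℝ fun k => P.root (α k)
  exists_sign : ∀ i, ∃ ε : ℝ, (ε = 1 ∨ ε = -1) ∧ IsConeCombination P α (ε • P.root i) ∧
    IsConeCombination P α (P.root θ - ε • P.root i)

namespace IsConeCombination

variable {x y : U} {v : V}

theorem add (hx : IsConeCombination P α x) (hy : IsConeCombination P α y) :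
    IsConeCombination P α (x + y) := by
  obtain ⟨c, hc, rfl⟩ := hx
  obtain ⟨d, hd, rfl⟩ := hy
  exact ⟨c + d, add_nonneg hc hd, by simp only [Pi.add_apply, add_smul, Finset.sum_add_distrib]⟩

theorem pairing_nonneg (hx : IsConeCombination P α x) (hv : ∀ k, 0 ≤ P.root' (α k) v) :
    0 ≤ P.toLinearMap x v := by
  obtain ⟨c, hc, rfl⟩ := hx
  rw [map_sum, LinearMap.sum_apply]
  refine Finset.sum_nonneg fun k _ => ?_
  rw [map_smul, LinearMap.smul_apply]
  exact mul_nonneg (hc k) (hv k)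

theorem pairing_pos (hx : IsConeCombination P α x) (hx0 : x ≠ 0)
    (hv : ∀ k, 0 < P.root' (α k) v) : 0 < P.toLinearMap x v := by
  obtain ⟨c, hc, rfl⟩ := hx
  obtain ⟨k, -, hk⟩ := Finset.exists_ne_zero_of_sum_ne_zero hx0
  simp only [map_sum, map_smul, LinearMap.sum_apply, LinearMap.smul_apply]
  refine Finset.sum_pos' (fun j _ => mul_nonneg (hc j) (hv j).le)
    ⟨k, Finset.mem_univ k, mul_pos ((hc k).lt_of_ne' ?_) (hv k)⟩
  intro h
  exact hk (by rw [h, Pi.zero_apply, zero_smul])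

/-- A face of the cone: if `v` vanishes only on the ray of `α k`, a combination on which `v`
vanishes lies on that ray. -/
theorem eq_smul_of_pairing_eq_zero (hx : IsConeCombination P α x) {k : κ}
    (hv : ∀ j ≠ k, 0 < P.root' (α j) v) (hk : P.root' (α k) v = 0) (hxv : P.toLinearMap x v = 0) :
    ∃ c : ℝ, x = c • P.root (α k) := by
  classical
  obtain ⟨c, hc, rfl⟩ := hx
  simp only [map_sum, map_smul, LinearMap.sum_apply, LinearMap.smul_apply] at hxv
  have hterm (j : κ) : 0 ≤ c j * P.root' (α j) v := by
    rcases eq_or_ne j k with rfl | hj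
    exacts [(mul_eq_zero_of_right _ hk).ge, mul_nonneg (hc j) (hv j hj).le]
  refine ⟨c k, Fintype.sum_eq_single k fun j hj => ?_⟩
  have hj0 := (Finset.sum_eq_zero_iff_of_nonneg fun j _ => hterm j).1 hxv j (Finset.mem_univ j)
  rw [(mul_eq_zero.1 hj0).resolve_right (hv j hj).ne', zero_smul]

end IsConeCombination

theorem affRefl_eq_of_smul_root_eq {ε : ℝ} (hε : ε = 1 ∨ ε = -1) {i j : ι}
    (h : ε • P.root i = P.root j) {k l : ℤ} (hkl : ε * k = l) : affRefl P i k = affRefl P j l := by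
  rcases hε with rfl | rfl
  · rw [one_smul] at h
    rw [one_mul, Int.cast_inj] at hkl
    rw [P.root.injective h, hkl]
  · rw [neg_one_smul, neg_eq_iff_eq_neg] at h
    rw [affRefl_of_root_eq_neg h, show -k = l by exact_mod_cast neg_one_mul (k : ℝ) ▸ hkl]

theorem affRefl_eq_refl_of_smul_root_eq [P.IsReduced] {ε c : ℝ} (hε : ε ≠ 0) {i j : ι}
    (h : ε • P.root i = c • P.root j) : affRefl P i 0 = refl P j := by
  have hdep : ¬ LinearIndependent ℝ ![P.root i, P.root j] := fun hindep =>
    hε (LinearIndependent.pair_iff.1 hindep ε (-c) (by rw [h, neg_smul, add_neg_cancel])).1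
  rw [RootPairing.IsReduced.linearIndependent_iff, not_and_or, not_ne_iff, not_ne_iff] at hdep
  rw [← affRefl_zero]
  rcases hdep with rfl | h
  · rfl
  · rw [affRefl_of_root_eq_neg h, neg_zero]

theorem root'_mem_Ioo {v : V} (hv : v ∈ alcove P α θ) {i : ι} {ε : ℝ} (hε : ε = 1 ∨ ε = -1)
    (hi : IsConeCombination P α (ε • P.root i))
    (hθi : IsConeCombination P α (P.root θ - ε • P.root i)) :
    ε * P.root' i v ∈ Set.Ioo 0 1 := by
  have hne : ε • P.root i ≠ 0 :=
    smul_ne_zero (by rcases hε with rfl | rfl <;> norm_num) (P.ne_zero i)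
  have hpos := hi.pairing_pos hne hv.1
  have hle := hθi.pairing_nonneg fun k => (hv.1 k).le
  rw [map_sub, LinearMap.sub_apply] at hle
  rw [map_smul, LinearMap.smul_apply] at hpos hle
  exact ⟨hpos, (sub_nonneg.1 hle).trans_lt hv.2⟩

theorem root'_mem_Icc {u : V} (hu : u ∈ closedAlcove P α θ) {i : ι} {ε : ℝ}
    (hi : IsConeCombination P α (ε • P.root i))
    (hθi : IsConeCombination P α (P.root θ - ε • P.root i)) :
    ε * P.root' i u ∈ Set.Icc 0 1 := by
  have hnonneg := hi.pairing_nonneg hu.1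
  have hle := hθi.pairing_nonneg hu.1
  rw [map_sub, LinearMap.sub_apply] at hle
  rw [map_smul, LinearMap.smul_apply] at hnonneg hle
  exact ⟨hnonneg, (sub_nonneg.1 hle).trans hu.2⟩

namespace IsBaseWithHighestRoot

variable (hb : IsBaseWithHighestRoot P α θ)
include hb

theorem exists_root'_eq (a : κ → ℝ) : ∃ v : V, ∀ k, P.root' (α k) v = a k := by
  classical
  obtain ⟨f, hf⟩ := LinearMap.dualMap_surjective_of_injective
    hb.linearIndependent.fintypeLinearCombination_injective (Fintype.linearCombination ℝ a)
  refine ⟨P.flip.toLinearMap.toPerfPair.symm f, fun k => ?_⟩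
  have hk : f (P.root (α k)) = a k := by
    simpa using LinearMap.congr_fun hf (Pi.single k 1)
  exact (P.toLinearMap.apply_toPerfPair_flip f _).trans hk

theorem sameSide_of_mem_alcove {u v : V} (hv : v ∈ alcove P α θ) (hu : u ∈ closedAlcove P α θ)
    {i : ι} {k : ℤ} (hne : affineRoot P i k u ≠ 0) : SameSide P i k v u := by
  obtain ⟨ε, hε, hi, hθi⟩ := hb.exists_sign i
  obtain ⟨hv0, hv1⟩ := root'_mem_Ioo hv hε hi hθi
  obtain ⟨hu0, hu1⟩ := root'_mem_Icc hu hi hθi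
  have hne' : P.root' i u ≠ k := sub_ne_zero.1 hne
  unfold SameSide affineRoot
  rcases hε with rfl | rfl
  · rcases le_or_gt k 0 with hk | hk
    · have : (k : ℝ) ≤ 0 := by exact_mod_cast hk
      exact mul_pos (by linarith) (sub_pos.2 (lt_of_le_of_ne' (by linarith) hne'))
    · have : (1 : ℝ) ≤ k := by exact_mod_cast hk
      exact mul_pos_of_neg_of_neg (by linarith) (sub_neg.2 (lt_of_le_of_ne (by linarith) hne'))
  · rcases le_or_gt 0 k with hk | hk
    · have : (0 : ℝ) ≤ k := by exact_mod_cast hk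
      exact mul_pos_of_neg_of_neg (by linarith) (sub_neg.2 (lt_of_le_of_ne (by linarith) hne'))
    · have : (k : ℝ) ≤ -1 := by exact_mod_cast Int.le_sub_one_of_lt hk
      exact mul_pos (by linarith) (sub_pos.2 (lt_of_le_of_ne' (by linarith) hne'))

theorem affineRoot_ne_zero {v : V} (hv : v ∈ alcove P α θ) (i : ι) (k : ℤ) :
    affineRoot P i k v ≠ 0 := by
  obtain ⟨ε, hε, hi, hθi⟩ := hb.exists_sign i
  obtain ⟨hv0, hv1⟩ := root'_mem_Ioo hv hε hi hθi
  intro h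
  rw [sub_eq_zero.1 h] at hv0 hv1
  rcases hε with rfl | rfl <;> norm_num at hv0 hv1 <;> norm_cast at hv0 hv1 <;> omega

theorem sameSide_alcove {u v : V} (hu : u ∈ alcove P α θ) (hv : v ∈ alcove P α θ) (i : ι) (k : ℤ) :
    SameSide P i k u v :=
  hb.sameSide_of_mem_alcove hu ⟨fun j => (hv.1 j).le, hv.2.le⟩ (hb.affineRoot_ne_zero hv i k)

theorem affRefl_eq_refl_of_mem_wall [P.IsReduced] {k : κ} {u : V} (hk : P.root' (α k) u = 0)
    (hpos : ∀ j ≠ k, 0 < P.root' (α j) u) (hθ : P.root' θ u < 1) {i : ι} {l : ℤ}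
    (hil : affineRoot P i l u = 0) : affRefl P i l = refl P (α k) := by
  obtain ⟨ε, hε, hi, hθi⟩ := hb.exists_sign i
  have hu : u ∈ closedAlcove P α θ := by
    refine ⟨fun j => ?_, hθ.le⟩
    rcases eq_or_ne j k with rfl | hj
    exacts [hk.ge, (hpos j hj).le]
  obtain ⟨hi0, -⟩ := root'_mem_Icc hu hi hθi
  have hle := hθi.pairing_nonneg hu.1
  have hlt : ε * P.root' i u < 1 := by
    rw [map_sub, LinearMap.sub_apply, map_smul, LinearMap.smul_apply] at hle
    exact (sub_nonneg.1 hle).trans_lt hθ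
  have hiu : P.root' i u = l := sub_eq_zero.1 hil
  have hl : l = 0 := by
    rw [hiu] at hi0 hlt
    rcases hε with rfl | rfl <;> norm_num at hi0 hlt <;> norm_cast at hi0 hlt <;> omega
  obtain ⟨c, hc⟩ := hi.eq_smul_of_pairing_eq_zero hpos hk <| by
    rw [map_smul, LinearMap.smul_apply]
    exact smul_eq_zero_of_right _ (by rw [← RootPairing.root', hiu, hl, Int.cast_zero])
  rw [hl]
  exact affRefl_eq_refl_of_smul_root_eq (by rcases hε with rfl | rfl <;> norm_num) hc

theorem affRefl_eq_affRefl_highest_of_mem_wall {u : V} (hpos : ∀ j, 0 < P.root' (α j) u)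
    (hθ : P.root' θ u = 1) {i : ι} {l : ℤ} (hil : affineRoot P i l u = 0) :
    affRefl P i l = affRefl P θ 1 := by
  obtain ⟨ε, hε, hi, hθi⟩ := hb.exists_sign i
  have hiu : P.root' i u = l := sub_eq_zero.1 hil
  have hi0 := hi.pairing_pos
    (smul_ne_zero (by rcases hε with rfl | rfl <;> norm_num) (P.ne_zero i)) hpos
  rw [map_smul, LinearMap.smul_apply, ← RootPairing.root', hiu, smul_eq_mul] at hi0
  obtain ⟨-, hi1⟩ := root'_mem_Icc ⟨fun j => (hpos j).le, hθ.le⟩ hi hθi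
  have hl : ε * l = 1 := by
    rw [hiu] at hi1
    rcases hε with rfl | rfl <;> norm_num at hi0 hi1 ⊢ <;> norm_cast at hi0 hi1 ⊢ <;> omega
  have hθi0 : P.root θ - ε • P.root i = 0 := by
    by_contra hne
    have := hθi.pairing_pos hne hpos
    rw [map_sub, LinearMap.sub_apply, map_smul, LinearMap.smul_apply] at this
    exact this.ne' (sub_eq_zero.2 (by rw [smul_eq_mul]; exact hθ.trans (hiu ▸ hl).symm))
  exact affRefl_eq_of_smul_root_eq hε (sub_eq_zero.1 hθi0).symm (by rw [hl, Int.cast_one])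

theorem exists_mem_wall (k : κ) :
    ∃ u, P.root' (α k) u = 0 ∧ (∀ j ≠ k, 0 < P.root' (α j) u) ∧ P.root' θ u < 1 := by
  classical
  obtain ⟨u, hu⟩ := hb.exists_root'_eq fun j => if j = k then 0 else 1
  refine ⟨(1 + |P.root' θ u|)⁻¹ • u, ?_, fun j hj => ?_, ?_⟩
  · rw [map_smul, hu, if_pos rfl, smul_zero]
  · rw [map_smul, hu, if_neg hj, smul_eq_mul]
    positivity
  · rw [map_smul, smul_eq_mul, inv_mul_lt_one₀ (by positivity)]
    linarith [le_abs_self (P.root' θ u)]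

theorem exists_mem_highest_wall : ∃ u, (∀ j, 0 < P.root' (α j) u) ∧ P.root' θ u = 1 := by
  obtain ⟨u, hu⟩ := hb.exists_root'_eq fun _ => 1
  have hu0 (j : κ) : 0 < P.root' (α j) u := by rw [hu]; exact one_pos
  obtain ⟨ε, -, hi, hθi⟩ := hb.exists_sign θ
  have hθ : 0 < P.root' θ u :=
    (by simpa using hθi.add hi : IsConeCombination P α (P.root θ)).pairing_pos (P.ne_zero θ) hu0
  refine ⟨(P.root' θ u)⁻¹ • u, fun j => ?_, ?_⟩
  · rw [map_smul, smul_eq_mul]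
    exact mul_pos (inv_pos.2 hθ) (hu0 j)
  · rw [map_smul, smul_eq_mul, inv_mul_cancel₀ hθ.ne']

theorem exists_fixed_point_of_mem_simpleAffine [P.IsReduced] {s : V ≃ᵃ[ℝ] V}
    (hs : s ∈ simpleAffine P α θ) : ∃ u ∈ closedAlcove P α θ, s u = u ∧
      ∀ i l, affineRoot P i l u = 0 → affRefl P i l = s := by
  rcases hs with ⟨k, rfl⟩ | rfl
  · obtain ⟨u, hk, hpos, hθ⟩ := hb.exists_mem_wall k
    refine ⟨u, ⟨fun j => ?_, hθ.le⟩, ?_, fun i l => hb.affRefl_eq_refl_of_mem_wall hk hpos hθ⟩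
    · rcases eq_or_ne j k with rfl | hj
      exacts [hk.ge, (hpos j hj).le]
    · rw [refl_apply, hk, zero_smul, sub_zero]
  · obtain ⟨u, hpos, hθ⟩ := hb.exists_mem_highest_wall
    rw [← affRefl_one]
    refine ⟨u, ⟨fun j => (hpos j).le, hθ.le⟩, ?_,
      fun i l => hb.affRefl_eq_affRefl_highest_of_mem_wall hpos hθ⟩
    rw [affRefl_apply, affineRoot, hθ, Int.cast_one, sub_self, zero_smul, sub_zero]

end IsBaseWithHighestRoot

namespace IsBaseWithHighestRoot

variable [P.IsCrystallographic] [P.IsReduced] (hb : IsBaseWithHighestRoot P α θ)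
include hb

/-- The chambers of `v₀` and `s v₀` share the facet of the fixed point `u`, so that a wall
separating them contains `u`. -/
theorem affRefl_eq_of_not_sameSide {s : V ≃ᵃ[ℝ] V} (hs : s ∈ simpleAffine P α θ) {v₀ : V}
    (hv₀ : v₀ ∈ alcove P α θ) {i : ι} {k : ℤ} (h : ¬ SameSide P i k v₀ (s v₀)) :
    affRefl P i k = s := by
  obtain ⟨u, hu, hsu, hwall⟩ := hb.exists_fixed_point_of_mem_simpleAffine hs
  by_contra hne
  have hiu : affineRoot P i k u ≠ 0 := fun h0 => hne (hwall i k h0)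
  obtain ⟨j, l, hcomap, -⟩ := exists_affineRoot_comap_of_mem_extAffineWeyl
    (mem_extAffineWeyl_of_mem_simpleAffine hs) i k
  have hju : affineRoot P j l u ≠ 0 := by rwa [← hcomap, hsu]
  have hsv : SameSide P i k (s v₀) (s u) :=
    (sameSide_map_iff hcomap).2 (hb.sameSide_of_mem_alcove hv₀ hu hju)
  rw [hsu] at hsv
  exact h ((hb.sameSide_of_mem_alcove hv₀ hu hiu).trans hsv.symm)

theorem exists_word_affRefl_mul {v₀ : V} (hv₀ : v₀ ∈ alcove P α θ) (l : List (V ≃ᵃ[ℝ] V))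
    (hl : ∀ s ∈ l, s ∈ simpleAffine P α θ) {i : ι} {k : ℤ}
    (h : ¬ SameSide P i k v₀ (l.prod v₀)) :
    ∃ l' : List (V ≃ᵃ[ℝ] V), (∀ s ∈ l', s ∈ simpleAffine P α θ) ∧
      l'.prod = affRefl P i k * l.prod ∧ l'.length < l.length := by
  induction l generalizing i k with
  | nil => exact absurd (hb.sameSide_alcove hv₀ hv₀ i k) h
  | cons s l ih =>
    obtain ⟨hs, hl⟩ := List.forall_mem_cons.1 hl
    rw [List.prod_cons] at h ⊢
    by_cases hsep : SameSide P i k v₀ (s v₀)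
    · obtain ⟨j, m, hcomap, hconj⟩ := exists_affineRoot_comap_of_mem_extAffineWeyl
        (mem_extAffineWeyl_of_mem_simpleAffine hs) i k
      obtain ⟨l', hl', hprod, hlen⟩ := ih hl (i := j) (k := m) fun hjm =>
        h (hsep.trans ((sameSide_map_iff hcomap).2 hjm))
      refine ⟨s :: l', List.forall_mem_cons.2 ⟨hs, hl'⟩, ?_, Nat.succ_lt_succ hlen⟩
      rw [List.prod_cons, hprod, ← mul_assoc, ← mul_assoc, hconj]
    · refine ⟨l, hl, ?_, Nat.lt_succ_self _⟩
      rw [hb.affRefl_eq_of_not_sameSide hs hv₀ hsep, ← mul_assoc,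
        mul_self_of_mem_simpleAffine hs, one_mul]

theorem sameSide_of_length_lt {v₀ : V} (hv₀ : v₀ ∈ alcove P α θ) {a : V ≃ᵃ[ℝ] V} {i : ι} {k : ℤ}
    (ha : a ∈ Subgroup.closure (simpleAffine P α θ))
    (hlt : Coxeter.length (simpleAffine P α θ) a <
      Coxeter.length (simpleAffine P α θ) (affRefl P i k * a)) :
    SameSide P i k v₀ (a v₀) := by
  by_contra h
  obtain ⟨l, hl, rfl, hlen⟩ := Coxeter.exists_reduced_word (fun _ => inv_of_mem_simpleAffine) ha
  obtain ⟨l', hl', hprod, hlen'⟩ := hb.exists_word_affRefl_mul hv₀ l hl h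
  have := Coxeter.length_prod_le hl'
  rw [hprod] at this
  omega

end IsBaseWithHighestRoot

end Alcove

/-! ### The Bruhat order in geometric terms -/

/-- `h` is obtained from `g` by a reflection whose wall does not separate `g v₀` from `v₀`. For `v₀`
in the base alcove these are the ascents of the Bruhat order, described without the length. -/
def IsAscent (P : RootPairing ι ℝ U V) (v₀ : V) (g h : V ≃ᵃ[ℝ] V) : Prop :=
  ∃ i k, h = affRefl P i k * g ∧ SameSide P i k v₀ (g v₀)

/-- The reflexive transitive closure of `IsAscent`: the Bruhat order in geometric terms. -/
def AscentLE (P : RootPairing ι ℝ U V) (v₀ : V) : (V ≃ᵃ[ℝ] V) → (V ≃ᵃ[ℝ] V) → Prop :=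
  Relation.ReflTransGen (IsAscent P v₀)

theorem isAscent_affRefl_mul {v₀ : V} {g : V ≃ᵃ[ℝ] V} {i : ι} {k : ℤ}
    (h : SameSide P i k v₀ (g v₀)) : IsAscent P v₀ g (affRefl P i k * g) :=
  ⟨i, k, rfl, h⟩

theorem isAscent_of_affRefl_mul {v₀ : V} {g : V ≃ᵃ[ℝ] V} {i : ι} {k : ℤ}
    (h : SameSide P i k v₀ (affRefl P i k (g v₀))) : IsAscent P v₀ (affRefl P i k * g) g :=
  ⟨i, k, by rw [← mul_assoc, affRefl_mul_self, one_mul], h⟩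

theorem AscentLE.eq_one {v₀ : V} {g : V ≃ᵃ[ℝ] V} (h : AscentLE P v₀ g 1) : g = 1 := by
  rcases Relation.ReflTransGen.cases_tail h with h | ⟨h, -, i, k, hprod, hside⟩
  · exact h.symm
  · rw [eq_inv_of_mul_eq_one_right hprod.symm, affRefl_inv, SameSide, affineRoot_affRefl] at hside
    exact absurd hside (by nlinarith [sq_nonneg (affineRoot P i k v₀)])

theorem AscentLE.mem_extAffineWeyl [P.IsCrystallographic] {v₀ : V} {g h : V ≃ᵃ[ℝ] V}
    (hgh : AscentLE P v₀ g h) (hg : g ∈ extAffineWeyl P) : h ∈ extAffineWeyl P := by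
  induction hgh with
  | refl => exact hg
  | tail _ hstep ih =>
    obtain ⟨i, k, rfl, -⟩ := hstep
    exact mul_mem (affRefl_mem_extAffineWeyl i k) ih

theorem IsAscent.sub_mem_of_convex {K : Set V} (hK : Convex ℝ K)
    (hstable : ∀ i, ∀ u ∈ K, P.coreflection i u ∈ K) {v₀ : V} {g h : V ≃ᵃ[ℝ] V}
    (hgh : IsAscent P v₀ g h) (hh : h v₀ - v₀ ∈ K) : g v₀ - v₀ ∈ K := by
  obtain ⟨i, k, rfl, hside⟩ := hgh
  set d := affineRoot P i k v₀ with hd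
  set c := affineRoot P i k (g v₀) with hc
  have hcd : 0 < d * c := hside
  have hne : d + c ≠ 0 := fun h0 => by
    rw [eq_neg_of_add_eq_zero_left h0] at hcd
    nlinarith [sq_nonneg c]
  have hreflect : P.coreflection i (affRefl P i k (g v₀) - v₀) =
      affRefl P i k (g v₀) - v₀ + (d + c) • P.coroot i := by
    have hpair : P.root' i (affRefl P i k (g v₀) - v₀) = -(d + c) := by
      have h1 := affineRoot_affRefl (P := P) i k (g v₀)
      rw [map_sub, hd, hc]
      simp only [affineRoot] at h1 ⊢
      linarith
    rw [P.coreflection_apply]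
    erw [hpair]
    module
  have hsegment : g v₀ - v₀ = (d / (d + c)) • (affRefl P i k (g v₀) - v₀) +
      (c / (d + c)) • P.coreflection i (affRefl P i k (g v₀) - v₀) := by
    rw [hreflect, smul_add, ← add_assoc, ← add_smul, ← add_div, div_self hne, one_smul, smul_smul,
      div_mul_cancel₀ _ hne, affRefl_apply]
    module
  rw [hsegment]
  refine hK hh (hstable i _ hh) ?_ ?_ (by rw [← add_div, div_self hne])
  all_goals
    rcases pos_and_pos_or_neg_and_neg_of_mul_pos hcd with ⟨hd0, hc0⟩ | ⟨hd0, hc0⟩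
  exacts [by positivity, div_nonneg_of_nonpos hd0.le (by linarith), by positivity,
    div_nonneg_of_nonpos hc0.le (by linarith)]

theorem AscentLE.sub_mem_of_convex {K : Set V} (hK : Convex ℝ K)
    (hstable : ∀ i, ∀ u ∈ K, P.coreflection i u ∈ K) {v₀ : V} {g h : V ≃ᵃ[ℝ] V}
    (hgh : AscentLE P v₀ g h) (hh : h v₀ - v₀ ∈ K) : g v₀ - v₀ ∈ K := by
  induction hgh with
  | refl => exact hh
  | tail _ hstep ih => exact ih (hstep.sub_mem_of_convex hK hstable hh)

section Bruhat

variable [Fintype κ] {α : κ → ι} {θ : ι}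

theorem sameSide_map_alcove (hb : IsBaseWithHighestRoot P α θ) {g : V ≃ᵃ[ℝ] V}
    (hg : g ∈ extAffineWeyl P) {u v : V} (hu : u ∈ alcove P α θ) (hv : v ∈ alcove P α θ)
    (i : ι) (k : ℤ) : SameSide P i k (g u) (g v) := by
  obtain ⟨j, l, hcomap, -⟩ := exists_affineRoot_comap_of_mem_extAffineWeyl hg i k
  exact (sameSide_map_iff hcomap).2 (hb.sameSide_alcove hu hv j l)

theorem sameSide_affRefl_of_not_sameSide (hb : IsBaseWithHighestRoot P α θ) {v₀ : V}
    (hv₀ : v₀ ∈ alcove P α θ) {g : V ≃ᵃ[ℝ] V} (hg : g ∈ extAffineWeyl P) {i : ι} {k : ℤ}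
    (h : ¬ SameSide P i k v₀ (g v₀)) : SameSide P i k v₀ (affRefl P i k (g v₀)) := by
  obtain ⟨j, l, hcomap, -⟩ := exists_affineRoot_comap_of_mem_extAffineWeyl hg i k
  have hne : affineRoot P i k v₀ * affineRoot P i k (g v₀) ≠ 0 :=
    mul_ne_zero (hb.affineRoot_ne_zero hv₀ i k) (hcomap v₀ ▸ hb.affineRoot_ne_zero hv₀ j l)
  rw [SameSide, affineRoot_affRefl, mul_neg, neg_pos]
  exact lt_of_le_of_ne (not_lt.1 h) hne

variable [P.IsCrystallographic] [P.IsReduced]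

theorem ExtBruhatLE.ascentLE (hb : IsBaseWithHighestRoot P α θ) {v₀ : V}
    (hv₀ : v₀ ∈ alcove P α θ) {x x' : V ≃ᵃ[ℝ] V} (h : ExtBruhatLE P α θ x x') :
    AscentLE P v₀ x x' := by
  obtain ⟨ω, ⟨-, hω⟩, y, -, y', -, rfl, rfl, hyy'⟩ := h
  refine Relation.ReflTransGen.lift (· * ω) (fun a b hab => ?_) _ _ hyy'
  obtain ⟨t, ht, rfl, hlt⟩ := hab
  have ha : a ∈ Subgroup.closure (simpleAffine P α θ) :=
    (mul_mem_cancel_left ht.mem_closure).1 (Coxeter.mem_closure_of_length_pos (pos_of_gt hlt))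
  obtain ⟨i, k, rfl⟩ := exists_affRefl_of_isReflection ht
  have hωv₀ : ω v₀ ∈ alcove P α θ := hω ▸ Set.mem_image_of_mem ω hv₀
  exact ⟨i, k, mul_assoc _ _ _, (hb.sameSide_of_length_lt hv₀ ha hlt).trans
    (sameSide_map_alcove hb (closure_simpleAffine_le ha) hv₀ hωv₀ i k)⟩

theorem IsAscent.mul_left_of_mem_simpleAffine (hb : IsBaseWithHighestRoot P α θ) {v₀ : V}
    (hv₀ : v₀ ∈ alcove P α θ) {s : V ≃ᵃ[ℝ] V} (hs : s ∈ simpleAffine P α θ) {g h : V ≃ᵃ[ℝ] V}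
    (hgh : IsAscent P v₀ g h) : h = s * g ∨ IsAscent P v₀ (s * g) (s * h) := by
  obtain ⟨i, k, rfl, hside⟩ := hgh
  obtain ⟨j, l, hcomap, hconj⟩ := exists_affineRoot_comap_of_mem_extAffineWeyl
    (mem_extAffineWeyl_of_mem_simpleAffine hs) i k
  have hss := mul_self_of_mem_simpleAffine hs
  have hconj' : affRefl P j l * s = s * affRefl P i k := by
    rw [← mul_right_inj s, ← mul_assoc, ← hconj, mul_assoc, hss, mul_one, ← mul_assoc, hss, one_mul]
  by_cases hsep : SameSide P j l v₀ (s v₀)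
  · refine .inr ⟨j, l, by rw [← mul_assoc, ← mul_assoc, hconj'], hsep.trans ?_⟩
    refine (sameSide_map_iff fun v => ?_).2 hside
    rw [← hcomap, ← mul_apply, hss]
    rfl
  · rw [hb.affRefl_eq_of_not_sameSide hs hv₀ hsep, mul_right_inj] at hconj'
    exact .inl (by rw [← hconj'])

/-- The lifting property of the Bruhat order: if `s b < b`, then `a ≤ b` implies `a ≤ s b` when
`a < s a`, and `s a ≤ s b` when `s a < a`. -/
theorem AscentLE.lifting (hb : IsBaseWithHighestRoot P α θ) {v₀ : V} (hv₀ : v₀ ∈ alcove P α θ)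
    {i : ι} {k : ℤ} (hs : affRefl P i k ∈ simpleAffine P α θ) {a b : V ≃ᵃ[ℝ] V}
    (ha : a ∈ extAffineWeyl P) (hab : AscentLE P v₀ a b) (hside : ¬ SameSide P i k v₀ (b v₀)) :
    (SameSide P i k v₀ (a v₀) → AscentLE P v₀ a (affRefl P i k * b)) ∧
      (¬ SameSide P i k v₀ (a v₀) → AscentLE P v₀ (affRefl P i k * a) (affRefl P i k * b)) := by
  induction hab using Relation.ReflTransGen.head_induction_on with
  | refl => exact ⟨fun h => absurd h hside, fun _ => .refl⟩
  | @head a c hstep hle ih =>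
    have hc : c ∈ extAffineWeyl P :=
      AscentLE.mem_extAffineWeyl (.single hstep) ha
    obtain ⟨ih_same, ih_not⟩ := ih hc
    have descent (hnot : ¬ SameSide P i k v₀ (a v₀)) : IsAscent P v₀ (affRefl P i k * a) a :=
      isAscent_of_affRefl_mul (sameSide_affRefl_of_not_sameSide hb hv₀ ha hnot)
    rcases hstep.mul_left_of_mem_simpleAffine hb hv₀ hs with rfl | hstep'
    · refine ⟨fun h => ?_, fun h => ih_same (sameSide_affRefl_of_not_sameSide hb hv₀ ha h)⟩
      have := ih_not (not_sameSide_affRefl h)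
      rwa [← mul_assoc, affRefl_mul_self, one_mul] at this
    · by_cases hcside : SameSide P i k v₀ (c v₀)
      · exact ⟨fun _ => .head hstep (ih_same hcside),
          fun h => .head (descent h) (.head hstep (ih_same hcside))⟩
      · exact ⟨fun h => .head (isAscent_affRefl_mul h) (.head hstep' (ih_not hcside)),
          fun _ => .head hstep' (ih_not hcside)⟩

end Bruhat

/-! ### Bruhat comparisons with translations by minuscule coweights -/

/-- The finite Weyl group, as a group of affine maps. -/
def linearWeyl (P : RootPairing ι ℝ U V) : Subgroup (V ≃ᵃ[ℝ] V) :=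
  Subgroup.closure (Set.range (refl P))

theorem refl_mem_linearWeyl (i : ι) : refl P i ∈ linearWeyl P :=
  Subgroup.subset_closure ⟨i, rfl⟩

theorem linearWeyl_le_extAffineWeyl : linearWeyl P ≤ extAffineWeyl P :=
  (Subgroup.closure_le _).2 <| Set.range_subset_iff.2 refl_mem_extAffineWeyl

theorem apply_zero_of_mem_linearWeyl {a : V ≃ᵃ[ℝ] V} (ha : a ∈ linearWeyl P) : a 0 = 0 := by
  induction ha using Subgroup.closure_induction with
  | mem _ h => obtain ⟨i, rfl⟩ := h; exact (P.coreflection i).map_zero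
  | one => rfl
  | mul x y _ _ hx hy => rw [mul_apply, hy, hx]
  | inv x _ hx => exact x.symm_apply_eq.2 hx.symm

theorem apply_eq_linear_of_mem_linearWeyl {a : V ≃ᵃ[ℝ] V} (ha : a ∈ linearWeyl P) (v : V) :
    a v = a.linear v := by
  rw [apply_eq_linear_add, apply_zero_of_mem_linearWeyl ha, add_zero]

theorem apply_add_of_mem_linearWeyl {a : V ≃ᵃ[ℝ] V} (ha : a ∈ linearWeyl P) (u v : V) :
    a (u + v) = a u + a v := by
  simp only [apply_eq_linear_of_mem_linearWeyl ha, map_add]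

theorem apply_mem_orbit_of_mem_linearWeyl {a : V ≃ᵃ[ℝ] V} (ha : a ∈ linearWeyl P) (μ : V) :
    a μ ∈ orbit P μ :=
  ⟨a.linear, (linearWeyl_le_extAffineWeyl ha).1, apply_eq_linear_of_mem_linearWeyl ha μ⟩

theorem mul_trans_of_mem_linearWeyl {a : V ≃ᵃ[ℝ] V} (ha : a ∈ linearWeyl P) (μ : V) :
    a * trans μ = trans (a μ) * a :=
  AffineEquiv.ext fun v => apply_add_of_mem_linearWeyl ha μ v

theorem exists_root_comap_of_mem_linearWeyl {a : V ≃ᵃ[ℝ] V} (ha : a ∈ linearWeyl P) (i : ι) :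
    ∃ j, (∀ v, P.root' i (a v) = P.root' j v) ∧ ∀ k, affRefl P i k * a = a * affRefl P j k := by
  have hext := linearWeyl_le_extAffineWeyl ha
  obtain ⟨j, hj, hji⟩ := exists_root_comap_of_mem_finiteWeyl hext.1 i
  have hlin := apply_eq_linear_of_mem_linearWeyl ha
  refine ⟨j, fun v => by rw [hlin]; exact hj v, fun k => AffineEquiv.ext fun v => ?_⟩
  rw [mul_apply, mul_apply, affRefl_apply, affRefl_apply, affineRoot, affineRoot, hlin, hlin,
    map_sub, map_smul]
  erw [hj, hji]

theorem exists_root_map_of_mem_linearWeyl {a : V ≃ᵃ[ℝ] V} (ha : a ∈ linearWeyl P) (j : ι) :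
    ∃ i, (∀ v, P.root' i (a v) = P.root' j v) ∧ ∀ k, affRefl P i k * a = a * affRefl P j k := by
  obtain ⟨i, hi, hconj⟩ := exists_root_comap_of_mem_linearWeyl (inv_mem ha) j
  refine ⟨i, fun v => ?_, fun k => ?_⟩
  · rw [← hi, ← mul_apply, inv_mul_cancel]
    rfl
  · have h := hconj k
    rw [eq_inv_mul_iff_mul_eq, ← mul_assoc, mul_inv_eq_iff_eq_mul] at h
    exact h.symm

theorem affRefl_mul_trans {i : ι} {m : ℤ} {μ : V} (hm : P.root' i μ = m) :
    affRefl P i m * trans μ = trans μ * refl P i := by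
  ext v
  rw [mul_apply, mul_apply, affRefl_apply, trans_apply, trans_apply, refl_apply, affineRoot,
    map_add, hm, add_sub_cancel_left, add_sub_assoc]

theorem IsMinuscule.exists_int {μ : V} (hμ : IsMinuscule P μ) (i : ι) :
    ∃ m : ℤ, P.root' i μ = m ∧ |m| ≤ 1 := by
  rcases hμ i with h | h | h
  exacts [⟨-1, by simpa using h, by decide⟩, ⟨0, by simpa using h, by decide⟩,
    ⟨1, by simpa using h, by decide⟩]

theorem eq_of_mul_trans_mul_inv_eq_trans {a b : V ≃ᵃ[ℝ] V} (ha : a ∈ linearWeyl P)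
    (hb : b ∈ linearWeyl P) {μ ν : V} (h : a * trans μ * b⁻¹ = trans ν) : a = b := by
  have happly (v : V) : a μ + a v = ν + b v := by
    have := DFunLike.congr_fun (mul_inv_eq_iff_eq_mul.1 h) v
    rwa [mul_apply, mul_apply, trans_apply, trans_apply, apply_add_of_mem_linearWeyl ha] at this
  have hzero := happly 0
  rw [apply_zero_of_mem_linearWeyl ha, apply_zero_of_mem_linearWeyl hb, add_zero, add_zero] at hzero
  ext v
  exact add_left_cancel (hzero ▸ happly v)

/-- Here `x`, `y`, `p` and `m` are the values of a root at four points, and `k` is the level of a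
wall: the bound forces `2k - m` into `{-1, 0, 1}`, so that `k` is `0` or `m`. -/
theorem level_eq_zero_or_eq {x y p : ℝ} {k m : ℤ} (hx : |x| < 1 / 2) (hy : |y| < 1 / 2) (hp : p ≠ 0)
    (hm : |m| ≤ 1) (hpm : 0 ≤ p * m) (hside : 0 < (y - k) * (m + x - k))
    (hbound : |2 * k - m - x - y| ≤ 1) : (k = 0 ∧ 0 < y * p) ∨ (k = m ∧ 0 < -(x * p)) := by
  obtain ⟨hx1, hx2⟩ := abs_lt.1 hx
  obtain ⟨hy1, hy2⟩ := abs_lt.1 hy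
  obtain ⟨hb1, hb2⟩ := abs_le.1 hbound
  have hlt : 2 * k - m < 2 := by exact_mod_cast (by linarith : (2 * k - m : ℝ) < 2)
  have hgt : -2 < 2 * k - m := by exact_mod_cast (by linarith : (-2 : ℝ) < 2 * k - m)
  obtain ⟨hm1, hm2⟩ := abs_le.1 hm
  obtain rfl | rfl | rfl : m = 0 ∨ m = 1 ∨ m = -1 := by omega
  · obtain rfl : k = 0 := by omega
    have hxy : 0 < y * x := by simpa using hside
    rcases lt_or_gt_of_ne (mul_ne_zero (left_ne_zero_of_mul hxy.ne') hp) with hyp | hyp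
    · have hneg := mul_neg_of_pos_of_neg hxy hyp
      rw [mul_mul_mul_comm] at hneg
      exact .inr ⟨rfl, neg_pos.2 (neg_of_mul_neg_right hneg (mul_self_nonneg y))⟩
    · exact .inl ⟨rfl, hyp⟩
  · have hp0 : 0 < p := lt_of_le_of_ne' (by simpa using hpm) hp
    obtain rfl | rfl : k = 0 ∨ k = 1 := by omega
    · exact .inl ⟨rfl, mul_pos (by push_cast at hside; nlinarith) hp0⟩
    · exact .inr ⟨rfl, neg_pos.2 (mul_neg_of_neg_of_pos (by push_cast at hside; nlinarith) hp0)⟩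
  · have hp0 : p < 0 := lt_of_le_of_ne (by simpa using hpm) hp
    obtain rfl | rfl : k = 0 ∨ k = -1 := by omega
    · exact .inl ⟨rfl, mul_pos_of_neg_of_neg (by push_cast at hside; nlinarith) hp0⟩
    · exact .inr ⟨rfl, neg_pos.2 (mul_neg_of_pos_of_neg (by push_cast at hside; nlinarith) hp0)⟩

theorem convex_abs_root'_le_one (P : RootPairing ι ℝ U V) :
    Convex ℝ {u : V | ∀ i, |P.root' i u| ≤ 1} := by
  intro u hu v hv s t hs ht hst i
  rw [map_add, map_smul, map_smul, smul_eq_mul, smul_eq_mul]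
  calc |s * P.root' i u + t * P.root' i v|
      ≤ |s * P.root' i u| + |t * P.root' i v| := abs_add_le _ _
    _ = s * |P.root' i u| + t * |P.root' i v| := by
      rw [abs_mul, abs_mul, abs_of_nonneg hs, abs_of_nonneg ht]
    _ ≤ s * 1 + t * 1 := by gcongr; exacts [hu i, hv i]
    _ = 1 := by rw [mul_one, mul_one, hst]

theorem IsMinuscule.abs_root'_le_one_of_ascentLE {ν : V} (hν : IsMinuscule P ν) {v₀ : V}
    {g : V ≃ᵃ[ℝ] V} (h : AscentLE P v₀ g (trans ν)) (i : ι) : |P.root' i (g v₀ - v₀)| ≤ 1 := by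
  suffices g v₀ - v₀ ∈ {u : V | ∀ i, |P.root' i u| ≤ 1} from this i
  refine h.sub_mem_of_convex (convex_abs_root'_le_one P) (fun j u hu i => ?_) fun i => ?_
  · obtain ⟨l, hl, -⟩ :=
      exists_root_comap_of_mem_finiteWeyl (P := P) (coreflection_mem_finiteWeyl j) i
    rw [hl]
    exact hu l
  · obtain ⟨m, hm, hm1⟩ := hν.exists_int i
    rw [trans_apply, add_sub_cancel_right, hm]
    exact_mod_cast hm1

/-- A step up from `a t_μ b⁻¹` towards a minuscule translation reflects in a wall of level `k`, and
since every element `z` below `t_ν` moves `v₀` by a vector `u` with all `|⟨β, u⟩| ≤ 1`, that wall is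
one of the two for which the step moves `a` up or `b` down. -/
theorem exists_of_isAscent_mul_trans_mul_inv {μ ν v₀ : V} (hμ : IsMinuscule P μ)
    (hν : IsMinuscule P ν) (hv₀ : ∀ i, P.root' i v₀ ≠ 0 ∧ |P.root' i v₀| < 1 / 2)
    (hμv₀ : ∀ i, 0 ≤ P.root' i v₀ * P.root' i μ) {a b : V ≃ᵃ[ℝ] V} (ha : a ∈ linearWeyl P)
    (hb : b ∈ linearWeyl P) {z : V ≃ᵃ[ℝ] V} (hz : IsAscent P v₀ (a * trans μ * b⁻¹) z)
    (hzν : AscentLE P v₀ z (trans ν)) :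
    ∃ a' ∈ linearWeyl P, ∃ b' ∈ linearWeyl P, z = a' * trans μ * b'⁻¹ ∧
      (a' = a ∧ IsAscent P v₀ b' b ∨ IsAscent P v₀ a a' ∧ b' = b) := by
  obtain ⟨i, k, rfl, hside⟩ := hz
  obtain ⟨j, hj, haj⟩ := exists_root_comap_of_mem_linearWeyl ha i
  obtain ⟨l, hl, hbl⟩ := exists_root_map_of_mem_linearWeyl hb j
  obtain ⟨m, hm, hm1⟩ := hμ.exists_int j
  have hz₀ : P.root' i ((a * trans μ * b⁻¹) v₀) = m + P.root' l v₀ := by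
    rw [mul_apply, mul_apply, hj, trans_apply, map_add, hm, ← hl, ← mul_apply, mul_inv_cancel]
    rfl
  have hbound : |2 * k - m - P.root' l v₀ - P.root' i v₀| ≤ 1 := by
    have h := hν.abs_root'_le_one_of_ascentLE hzν i
    have hrefl := affineRoot_affRefl (P := P) i k ((a * trans μ * b⁻¹) v₀)
    rw [affineRoot, affineRoot, hz₀, sub_eq_iff_eq_add] at hrefl
    rw [mul_apply, map_sub, hrefl] at h
    convert h using 2
    ring
  have hside' : 0 < (P.root' i v₀ - k) * (m + P.root' l v₀ - k) := by
    rwa [SameSide, affineRoot, affineRoot, hz₀] at hside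
  rcases level_eq_zero_or_eq (hv₀ l).2 (hv₀ i).2 (hv₀ j).1 hm1 (hm ▸ hμv₀ j) hside' hbound
    with ⟨rfl, hpos⟩ | ⟨rfl, hpos⟩
  · refine ⟨affRefl P i 0 * a, mul_mem (affRefl_zero (P := P) i ▸ refl_mem_linearWeyl i) ha, b, hb,
      by simp only [mul_assoc], .inr ⟨isAscent_affRefl_mul ?_, rfl⟩⟩
    rwa [SameSide, affineRoot, affineRoot, Int.cast_zero, sub_zero, sub_zero, hj]
  · refine ⟨a, ha, b * refl P j, mul_mem hb (refl_mem_linearWeyl j), ?_, .inl ⟨rfl, ?_⟩⟩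
    · rw [mul_inv_rev, ← affRefl_zero, affRefl_inv, affRefl_zero, ← mul_assoc, ← mul_assoc, haj,
        mul_assoc a, affRefl_mul_trans hm]
      simp only [mul_assoc]
    · rw [← affRefl_zero, ← hbl]
      refine isAscent_of_affRefl_mul ?_
      rwa [SameSide, affineRoot_affRefl, affineRoot, affineRoot, Int.cast_zero, sub_zero, sub_zero,
        hl, mul_neg]

theorem AscentLE.of_mul_trans_mul_inv {μ ν v₀ : V} (hμ : IsMinuscule P μ) (hν : IsMinuscule P ν)
    (hv₀ : ∀ i, P.root' i v₀ ≠ 0 ∧ |P.root' i v₀| < 1 / 2)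
    (hμv₀ : ∀ i, 0 ≤ P.root' i v₀ * P.root' i μ) {a b : V ≃ᵃ[ℝ] V} (ha : a ∈ linearWeyl P)
    (hb : b ∈ linearWeyl P) (h : AscentLE P v₀ (a * trans μ * b⁻¹) (trans ν)) :
    AscentLE P v₀ a b := by
  generalize hz : a * trans μ * b⁻¹ = z at h
  induction h using Relation.ReflTransGen.head_induction_on generalizing a b with
  | refl => exact eq_of_mul_trans_mul_inv_eq_trans ha hb hz ▸ .refl
  | head hstep hle ih =>
    subst hz
    obtain ⟨a', ha', b', hb', rfl, ⟨rfl, hbb'⟩ | ⟨haa', rfl⟩⟩ :=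
      exists_of_isAscent_mul_trans_mul_inv hμ hν hv₀ hμv₀ ha hb hstep hle
    exacts [.tail (ih ha' hb' rfl) hbb', .head haa' (ih ha' hb' rfl)]

/-! ### Invariance under the finite Weyl group -/

theorem IsMinuscule.map {μ : V} (hμ : IsMinuscule P μ) {w : V ≃ₗ[ℝ] V} (hw : w ∈ finiteWeyl P) :
    IsMinuscule P (w μ) := by
  intro i
  obtain ⟨j, hj, -⟩ := exists_root_comap_of_mem_finiteWeyl hw i
  rw [hj]
  exact hμ j

theorem IsMinuscule.mem_coweightLattice {μ : V} (hμ : IsMinuscule P μ) : μ ∈ coweightLattice P :=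
  fun i => (hμ.exists_int i).imp fun _ => And.left

theorem exists_isDominant_of_finite_orbit {α : κ → ι} {f : V →ₗ[ℝ] ℝ}
    (hf : ∀ k, 0 < f (P.coroot (α k))) {μ : V} (hfin : (orbit P μ).Finite) :
    ∃ w ∈ finiteWeyl P, IsDominant P α (w μ) := by
  obtain ⟨_, ⟨w, hw, rfl⟩, hmax⟩ :=
    Set.exists_max_image (orbit P μ) f hfin ⟨μ, 1, one_mem _, rfl⟩
  refine ⟨w, hw, fun k => le_of_not_gt fun hneg => ?_⟩
  have hle := hmax (P.coreflection (α k) (w μ))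
    ⟨P.coreflection (α k) * w, mul_mem (coreflection_mem_finiteWeyl _) hw, rfl⟩
  rw [P.coreflection_apply, map_sub, map_smul, smul_eq_mul, sub_le_self_iff] at hle
  exact hle.not_gt (mul_neg_of_neg_of_pos hneg (hf k))

theorem orbit_map {w : V ≃ₗ[ℝ] V} (hw : w ∈ finiteWeyl P) (μ : V) : orbit P (w μ) = orbit P μ := by
  ext v
  constructor
  · rintro ⟨u, hu, rfl⟩
    exact ⟨u * w, mul_mem hu hw, rfl⟩
  · rintro ⟨u, hu, rfl⟩
    exact ⟨u * w⁻¹, mul_mem hu (inv_mem hw), congrArg u (w.symm_apply_apply μ).symm⟩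

theorem Adm_eq_of_orbit_eq {α : κ → ι} {θ : ι} {μ ν : V} (h : orbit P μ = orbit P ν) :
    Adm P α θ μ = Adm P α θ ν := by
  have hexists (μ : V) (x : V ≃ᵃ[ℝ] V) : (∃ w ∈ finiteWeyl P, ExtBruhatLE P α θ x (trans (w μ))) ↔
      ∃ v ∈ orbit P μ, ExtBruhatLE P α θ x (trans v) :=
    ⟨fun ⟨w, hw, hx⟩ => ⟨w μ, ⟨w, hw, rfl⟩, hx⟩, fun ⟨_, ⟨w, hw, hv⟩, hx⟩ => ⟨w, hw, hv ▸ hx⟩⟩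
  ext x
  exact and_congr_right' (by rw [hexists, hexists, h])

theorem map_sub_self_mem_corootLattice {w : V ≃ₗ[ℝ] V} (hw : w ∈ finiteWeyl P) {μ : V}
    (hμ : μ ∈ coweightLattice P) : w μ - μ ∈ corootLattice P := by
  have reflection (i : ι) {μ : V} (hμ : μ ∈ coweightLattice P) :
      P.coreflection i μ - μ ∈ corootLattice P := by
    obtain ⟨n, hn⟩ := hμ i
    rw [P.coreflection_apply, sub_sub_cancel_left]
    erw [hn]
    rw [Int.cast_smul_eq_zsmul]
    exact neg_mem (zsmul_mem (coroot_mem_corootLattice i) n)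
  induction hw using Subgroup.closure_induction'' generalizing μ with
  | one => simp
  | mem _ h => obtain ⟨i, rfl⟩ := h; exact reflection i hμ
  | inv_mem _ h => obtain ⟨i, rfl⟩ := h; rw [P.coreflection_inv]; exact reflection i hμ
  | mul x y _ hy hx ihy =>
    have := add_mem (hx (coweightLattice_stable P y hy μ hμ)) (ihy hμ)
    rwa [sub_add_sub_cancel] at this

theorem mul_inv_mem_affineWeyl {g h : V ≃ᵃ[ℝ] V} (hg : g ∈ extAffineWeyl P)
    (hh : h ∈ extAffineWeyl P) (hgh : g 0 - h 0 ∈ corootLattice P) : g * h⁻¹ ∈ affineWeyl P := by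
  have hlin : (g * h⁻¹).linear ∈ finiteWeyl P := mul_mem hg.1 (inv_mem hh.1)
  have hzero : (g * h⁻¹) 0 = g 0 - h 0 - ((g * h⁻¹).linear (h 0) - h 0) := by
    have happly : (g * h⁻¹) (h 0) = g 0 := congrArg g (h.symm_apply_apply 0)
    rw [apply_eq_linear_add] at happly
    rw [← happly]
    abel
  exact ⟨hlin, hzero ▸ sub_mem hgh (map_sub_self_mem_corootLattice hlin hh.2)⟩

theorem trans_mem_affineWeyl {ν : V} (hν : ν ∈ corootLattice P) : trans ν ∈ affineWeyl P :=
  ⟨(finiteWeyl P).one_mem, by simpa [trans] using hν⟩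

theorem trans_mul_trans (u v : V) : trans u * trans v = trans (u + v) :=
  AffineEquiv.ext fun w => (add_assoc u v w).symm

theorem Perm_subset_Perm_map [TopologicalSpace V] {α : κ → ι} {θ : ι} {w : V ≃ₗ[ℝ] V}
    (hw : w ∈ finiteWeyl P) {μ : V} (hμ : μ ∈ coweightLattice P) :
    Perm P α θ μ ⊆ Perm P α θ (w μ) := by
  rintro x ⟨hx, ⟨ω, hω, y₁, hy₁, y₂, hy₂, hxω, hμω⟩, hhull⟩
  refine ⟨hx, ⟨ω, hω, y₁, hy₁, trans (w μ - μ) * y₂, mul_mem (trans_mem_affineWeyl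
    (map_sub_self_mem_corootLattice hw hμ)) hy₂, hxω, ?_⟩, by rwa [orbit_map hw]⟩
  rw [mul_assoc, ← hμω, trans_mul_trans, sub_add_cancel]

end AffineWeyl

namespace E7

/-! ### The roots of `E₇` -/

variable {r t : Fin 7 → ℤ} {i : Fin 7}

theorem mulVec_eq (r : Fin 7 → ℤ) : CartanMatrix.E₇ *ᵥ r =
    ![2 * r 0 - r 2, 2 * r 1 - r 3, 2 * r 2 - r 0 - r 3, 2 * r 3 - r 1 - r 2 - r 4,
      2 * r 4 - r 3 - r 5, 2 * r 5 - r 4 - r 6, 2 * r 6 - r 5] := by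
  funext i
  rw [Matrix.mulVec, dotProduct, Fin.sum_univ_seven]
  fin_cases i <;> simp [CartanMatrix.E₇] <;> ring

theorem form_neg_left (r t : Fin 7 → ℤ) : form (-r) t = -form r t := by
  rw [form, neg_dotProduct, form]

theorem form_single_right (r : Fin 7 → ℤ) (i : Fin 7) :
    form r (Pi.single i 1) = (CartanMatrix.E₇ *ᵥ r) i := by
  rw [form_comm, form, single_dotProduct, one_mul]

theorem form_single_nonpos (hr : 0 ≤ r) (hi : r i = 0) : form r (Pi.single i 1) ≤ 0 := by
  rw [form_single_right, Matrix.mulVec, dotProduct]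
  refine Finset.sum_nonpos fun j _ => ?_
  obtain rfl | hij := eq_or_ne i j
  · rw [hi, mul_zero]
  · exact mul_nonpos_of_nonpos_of_nonneg (CartanMatrix.E₇_off_diag_nonpos i j hij) (hr j)

theorem form_self_eq_sum_sq (r : Fin 7 → ℤ) :
    12 * form r r = 6 * (2 * r 0 - r 2) ^ 2 + 2 * (3 * r 2 - 2 * r 3) ^ 2 +
      6 * (2 * r 1 - r 3) ^ 2 + 6 * (2 * r 6 - r 5) ^ 2 + 2 * (3 * r 5 - 2 * r 4) ^ 2 +
      (4 * r 4 - 3 * r 3) ^ 2 + r 3 ^ 2 := by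
  rw [form, mulVec_eq, dotProduct, Fin.sum_univ_seven]
  simp only [Matrix.cons_val]
  ring

theorem form_self_pos (hr : r ≠ 0) : 0 < form r r := by
  have hsum := form_self_eq_sum_sq r
  refine lt_of_le_of_ne (by nlinarith) fun h => hr ?_
  rw [← h] at hsum
  have h3 : r 3 = 0 := by nlinarith
  have h4 : r 4 = 0 := by nlinarith
  have h5 : r 5 = 0 := by nlinarith
  have h6 : r 6 = 0 := by nlinarith
  have h1 : r 1 = 0 := by nlinarith
  have h2 : r 2 = 0 := by nlinarith
  have h0 : r 0 = 0 := by nlinarith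
  funext i
  fin_cases i <;> assumption

theorem form_le_one (hr : form r r = 2) (ht : form t t = 2) (hrt : r ≠ t) : form r t ≤ 1 := by
  have h := form_self_pos (sub_ne_zero.2 hrt)
  rw [form_sub_left, form_sub_right, form_sub_right, form_comm t r, hr, ht] at h
  omega

theorem IsRoot.neg (hr : IsRoot r) : IsRoot (-r) := by
  have h := hr.reflect_mem r hr
  rwa [E7.reflect, hr.form_self, show r - (2 : ℤ) • r = -r by module] at h

theorem reflect_single_apply_of_ne {j : Fin 7} (h : j ≠ i) (r : Fin 7 → ℤ) :
    reflect (Pi.single i 1) r j = r j := by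
  simp [reflect, h]

theorem reflect_single_apply_self (i : Fin 7) (r : Fin 7 → ℤ) :
    reflect (Pi.single i 1) r i = r i - form r (Pi.single i 1) := by
  simp [reflect]

theorem form_highestRoot_single_nonneg (i : Fin 7) :
    0 ≤ form highestRoot.1 (Pi.single i 1) := by
  revert i
  decide

theorem reflect_single_mem_Icc (hr : form r r = 2) (hri : r ≠ Pi.single i 1)
    (h : r ∈ Set.Icc 0 highestRoot.1) :
    reflect (Pi.single i 1) r ∈ Set.Icc 0 highestRoot.1 := by
  have hle := form_le_one hr (form_single i) hri
  have hge : form (-r) (Pi.single i 1) ≤ 1 := by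
    have hself : form (-r) (-r) = 2 := by
      rw [form_neg_left, form_comm, form_neg_left, neg_neg, hr]
    refine form_le_one hself (form_single i) fun heq => (h.1 i).not_gt ?_
    rw [neg_eq_iff_eq_neg.1 heq, Pi.neg_apply, Pi.single_eq_same]
    exact neg_one_lt_zero
  have hbot : 0 < r i ∨ form r (Pi.single i 1) ≤ 0 :=
    (h.1 i).lt_or_eq.imp_right fun heq => form_single_nonpos h.1 heq.symm
  have htop : r i < highestRoot.1 i ∨ 0 ≤ form r (Pi.single i 1) :=
    (h.2 i).lt_or_eq.imp_right fun heq => by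
      have hsub := form_single_nonpos (sub_nonneg.2 h.2) (sub_eq_zero.2 heq.symm)
      rw [form_sub_left] at hsub
      linarith [form_highestRoot_single_nonneg i]
  rw [form_neg_left] at hge
  suffices h' : ∀ j, 0 ≤ reflect (Pi.single i 1) r j ∧
      reflect (Pi.single i 1) r j ≤ highestRoot.1 j from ⟨fun j => (h' j).1, fun j => (h' j).2⟩
  intro j
  have hj : 0 ≤ r j ∧ r j ≤ highestRoot.1 j := ⟨h.1 j, h.2 j⟩
  obtain rfl | hne := eq_or_ne j i
  · rw [reflect_single_apply_self]
    omega
  · rwa [reflect_single_apply_of_ne hne]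

theorem single_mem_Icc (i : Fin 7) : Pi.single i 1 ∈ Set.Icc 0 highestRoot.1 := by
  rw [Set.mem_Icc, Pi.le_def, Pi.le_def]
  revert i
  decide

theorem IsRoot.mem_Icc_or_neg_mem_Icc (hr : IsRoot r) :
    r ∈ Set.Icc 0 highestRoot.1 ∨ -r ∈ Set.Icc 0 highestRoot.1 := by
  induction hr with
  | simple i => exact Or.inl (single_mem_Icc i)
  | reflect i r hr ih =>
    have hneg (t : Fin 7 → ℤ) :
        E7.reflect (Pi.single i 1) (-t) = -E7.reflect (Pi.single i 1) t := by
      rw [E7.reflect, E7.reflect, form_neg_left]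
      module
    have hself : E7.reflect (Pi.single i 1) (Pi.single i 1) = -Pi.single i 1 := by
      rw [E7.reflect, form_single]
      module
    obtain rfl | hri := eq_or_ne r (Pi.single i 1)
    · right
      rw [hself, neg_neg]
      exact single_mem_Icc i
    obtain hri' | hri' := eq_or_ne (-r) (Pi.single i 1)
    · left
      rw [← neg_neg r, hneg, hri', hself, neg_neg]
      exact single_mem_Icc i
    refine ih.imp (reflect_single_mem_Icc hr.form_self hri) fun h => ?_
    rw [← hneg]
    exact reflect_single_mem_Icc hr.neg.form_self hri' h

/-- The vector of `V = ℝ⁷`, or of `U = ℝ⁷`, with the given integral coordinates. -/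
def castVec (m : Fin 7 → ℤ) : Fin 7 → ℝ := fun i => m i

theorem castVec_injective : Function.Injective castVec := fun _ _ h =>
  funext fun i => Int.cast_injective (congrFun h i)

theorem castVec_neg (m : Fin 7 → ℤ) : castVec (-m) = -castVec m :=
  funext fun i => Int.cast_neg (m i)

theorem castVec_sub (m n : Fin 7 → ℤ) : castVec (m - n) = castVec m - castVec n :=
  funext fun i => Int.cast_sub (m i) (n i)

theorem castVec_dotProduct (m n : Fin 7 → ℤ) : castVec m ⬝ᵥ castVec n = (m ⬝ᵥ n : ℤ) := by
  simp [castVec, dotProduct]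

theorem root_apply (r : Root) : rootSystem.root r = castVec r.1 := rfl

theorem coroot_apply (r : Root) : rootSystem.coroot r = castVec (CartanMatrix.E₇ *ᵥ r.1) := rfl

theorem root'_apply (r : Root) (v : Fin 7 → ℝ) : rootSystem.root' r v = castVec r.1 ⬝ᵥ v := rfl

theorem root'_simpleRoot (i : Fin 7) (v : Fin 7 → ℝ) : rootSystem.root' (simpleRoot i) v = v i := by
  rw [root'_apply]
  simp [castVec, simpleRoot, dotProduct, Pi.single_apply]

theorem root_simpleRoot (i : Fin 7) : rootSystem.root (simpleRoot i) = Pi.single i 1 := by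
  funext j
  simp [root_apply, castVec, simpleRoot, Pi.single_apply]

theorem pairing_eq (r t : Root) : rootSystem.pairing r t = form r.1 t.1 :=
  cast_dotProduct r.1 t.1

instance : rootSystem.IsCrystallographic :=
  ⟨fun r t => ⟨form r.1 t.1, (pairing_eq r t).symm⟩⟩

instance : rootSystem.IsReduced := by
  refine rootSystem.isReduced_iff'.2 fun r t hrt hlin => ?_
  have hdep := rootSystem.pairing_smul_root_eq_of_not_linearIndependent hlin
  have hsq : form t.1 r.1 ^ 2 = 4 := by
    have h := congrArg (fun u => rootSystem.toLinearMap u (rootSystem.coroot t)) hdep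
    simp only [map_smul, LinearMap.smul_apply, smul_eq_mul, RootPairing.root_coroot_eq_pairing,
      RootPairing.pairing_same, pairing_eq, form_comm r.1 t.1] at h
    rw [sq, ← Int.cast_inj (α := ℝ), Int.cast_mul, h]
    norm_num
  rw [pairing_eq] at hdep
  obtain h | h := sq_eq_sq_iff_eq_or_eq_neg.1 (hsq.trans (by norm_num : (4 : ℤ) = 2 ^ 2))
  · rw [h, Int.cast_ofNat] at hdep
    exact absurd (rootSystem.root.injective (smul_right_injective _ two_ne_zero hdep)) hrt
  · rw [h, Int.cast_neg, Int.cast_ofNat, neg_smul, ← smul_neg] at hdep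
    exact neg_eq_iff_eq_neg.1 (smul_right_injective _ two_ne_zero hdep)

theorem isConeCombination_castVec {c : Fin 7 → ℤ} (hc : 0 ≤ c) :
    AffineWeyl.IsConeCombination rootSystem simpleRoot (castVec c) := by
  refine ⟨castVec c, fun i => Int.cast_nonneg (hc i), ?_⟩
  simp only [root_simpleRoot]
  exact (pi_eq_sum_univ' _)

theorem isBaseWithHighestRoot :
    AffineWeyl.IsBaseWithHighestRoot rootSystem simpleRoot highestRoot where
  linearIndependent := by
    simp only [root_simpleRoot]
    exact Pi.linearIndependent_single_one _ _
  exists_sign r := by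
    obtain ⟨h0, h1⟩ | ⟨h0, h1⟩ := r.2.mem_Icc_or_neg_mem_Icc
    · refine ⟨1, Or.inl rfl, ?_, ?_⟩
      · rw [one_smul]
        exact isConeCombination_castVec h0
      · rw [one_smul, root_apply, root_apply, ← castVec_sub]
        exact isConeCombination_castVec (sub_nonneg.2 h1)
    · refine ⟨-1, Or.inr rfl, ?_, ?_⟩
      · rw [neg_one_smul, root_apply, ← castVec_neg]
        exact isConeCombination_castVec h0
      · rw [neg_one_smul, root_apply, root_apply, ← castVec_neg, ← castVec_sub]
        exact isConeCombination_castVec (sub_nonneg.2 h1)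

/-! ### Minuscule coweights of `E₇` -/

theorem root'_rho7 (r : Root) : rootSystem.root' r rho7 = r.1 6 := by
  rw [root'_apply, rho7, dotProduct_single_one, castVec]

theorem isMinuscule_rho7 : AffineWeyl.IsMinuscule rootSystem rho7 := by
  intro r
  have htop : highestRoot.1 6 = 1 := rfl
  rw [root'_rho7]
  norm_cast
  obtain h | h := r.2.mem_Icc_or_neg_mem_Icc
  · have h0 : 0 ≤ r.1 6 := h.1 6
    have h1 : r.1 6 ≤ _ := h.2 6
    omega
  · have h0 : 0 ≤ -r.1 6 := h.1 6
    have h1 : -r.1 6 ≤ _ := h.2 6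
    omega

theorem eq_rho7_of_isDominant {μ : Fin 7 → ℝ} (hμ : AffineWeyl.IsMinuscule rootSystem μ)
    (hdom : AffineWeyl.IsDominant rootSystem simpleRoot μ) (hμ0 : μ ≠ 0) : μ = rho7 := by
  have hnonneg (i : Fin 7) : 0 ≤ μ i := by simpa only [root'_simpleRoot] using hdom i
  have hcoord (i : Fin 7) : μ i = 0 ∨ μ i = 1 := by
    have hi := hμ (simpleRoot i)
    rw [root'_simpleRoot] at hi
    exact hi.resolve_left fun h => (hnonneg i).not_gt (h ▸ neg_one_lt_zero)
  have hθ : castVec highestRoot.1 ⬝ᵥ μ ≤ 1 := by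
    rw [← root'_apply]
    rcases hμ highestRoot with h | h | h <;> rw [h] <;> norm_num
  have hcoeff : ∀ i ≠ 6, 2 ≤ highestRoot.1 i := by decide
  have hzero (i : Fin 7) (hi : i ≠ 6) : μ i = 0 := by
    refine (hcoord i).resolve_right fun h => ?_
    have hcast : (2 : ℝ) ≤ castVec highestRoot.1 i := by
      rw [castVec]
      exact_mod_cast hcoeff i hi
    have hle : castVec highestRoot.1 i * μ i ≤ castVec highestRoot.1 ⬝ᵥ μ :=
      Finset.single_le_sum (f := fun j => castVec highestRoot.1 j * μ j)
        (fun j _ => mul_nonneg (Int.cast_nonneg (by revert j; decide)) (hnonneg j))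
        (Finset.mem_univ i)
    rw [h, mul_one] at hle
    linarith
  have hone : μ 6 = 1 := by
    refine (hcoord 6).resolve_left fun h => hμ0 (funext fun i => ?_)
    obtain rfl | hi := eq_or_ne i 6
    exacts [h, hzero i hi]
  funext i
  obtain rfl | hi := eq_or_ne i 6
  · rw [hone, rho7, Pi.single_eq_same]
  · rw [hzero i hi, rho7, Pi.single_eq_of_ne hi]

theorem isDominant_rho7 : AffineWeyl.IsDominant rootSystem simpleRoot rho7 := fun i => by
  rw [root'_simpleRoot, rho7]
  exact (Pi.single_nonneg (α := fun _ : Fin 7 => ℝ)).2 zero_le_one i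

theorem rho7_ne_zero : rho7 ≠ 0 := Pi.single_ne_zero_iff.2 one_ne_zero

theorem mem_coweightLattice_and_isMinuscule_and_isDominant_iff (μ : Fin 7 → ℝ) :
    (μ ∈ AffineWeyl.coweightLattice rootSystem ∧ AffineWeyl.IsMinuscule rootSystem μ ∧
      AffineWeyl.IsDominant rootSystem simpleRoot μ ∧ μ ≠ 0) ↔ μ = rho7 := by
  constructor
  · rintro ⟨-, hμ, hdom, hμ0⟩
    exact eq_rho7_of_isDominant hμ hdom hμ0
  · rintro rfl
    exact ⟨isMinuscule_rho7.mem_coweightLattice, isMinuscule_rho7, isDominant_rho7, rho7_ne_zero⟩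

theorem finite_orbit {μ : Fin 7 → ℝ} (hμ : AffineWeyl.IsMinuscule rootSystem μ) :
    (AffineWeyl.orbit rootSystem μ).Finite := by
  refine (Set.Finite.pi' fun _ : Fin 7 => Set.toFinite ({-1, 0, 1} : Set ℝ)).subset ?_
  rintro _ ⟨w, hw, rfl⟩ i
  have h := hμ.map hw (simpleRoot i)
  rwa [root'_simpleRoot] at h

theorem exists_map_eq_rho7 {μ : Fin 7 → ℝ} (hμ : AffineWeyl.IsMinuscule rootSystem μ)
    (hμ0 : μ ≠ 0) : ∃ w ∈ AffineWeyl.finiteWeyl rootSystem, w μ = rho7 := by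
  -- The functional is the sum of the positive roots, which takes the value 2 on simple coroots.
  obtain ⟨w, hw, hdom⟩ := AffineWeyl.exists_isDominant_of_finite_orbit (α := simpleRoot)
    (f := dotProductBilin ℝ ℝ (castVec ![34, 49, 66, 96, 75, 52, 27])) (fun k => by
      change 0 < castVec _ ⬝ᵥ castVec _
      rw [castVec_dotProduct, Int.cast_pos]
      revert k
      decide) (finite_orbit hμ)
  exact ⟨w, hw, eq_rho7_of_isDominant (hμ.map hw) hdom ((map_ne_zero_iff w w.injective).2 hμ0)⟩

/-! ### Words, and Bruhat comparison along a reduced word -/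

/-- The action of the simple reflection with index `j` on integral vectors of `V`. -/
def simpleAct (j : Fin 7) (m : Fin 7 → ℤ) : Fin 7 → ℤ :=
  m - m j • (CartanMatrix.E₇ *ᵥ Pi.single j 1)

/-- The element of the finite Weyl group given by a word in the indices of the simple roots. -/
noncomputable def word (l : List (Fin 7)) : (Fin 7 → ℝ) ≃ᵃ[ℝ] (Fin 7 → ℝ) :=
  (l.map fun j => AffineWeyl.refl rootSystem (simpleRoot j)).prod

theorem word_cons (j : Fin 7) (l : List (Fin 7)) :
    word (j :: l) = AffineWeyl.refl rootSystem (simpleRoot j) * word l :=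
  List.prod_cons

theorem word_mem_linearWeyl (l : List (Fin 7)) : word l ∈ AffineWeyl.linearWeyl rootSystem :=
  list_prod_mem <| List.forall_mem_map.2 fun _ _ => AffineWeyl.refl_mem_linearWeyl _

theorem refl_simpleRoot_castVec (j : Fin 7) (m : Fin 7 → ℤ) :
    AffineWeyl.refl rootSystem (simpleRoot j) (castVec m) = castVec (simpleAct j m) := by
  rw [AffineWeyl.refl_apply, root'_simpleRoot, coroot_apply, simpleAct, castVec_sub]
  congr 1
  funext i
  exact (Int.cast_mul _ _).symm

theorem word_castVec (l : List (Fin 7)) (m : Fin 7 → ℤ) :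
    word l (castVec m) = castVec (l.foldr simpleAct m) := by
  induction l with
  | nil => rfl
  | cons j l ih =>
    rw [word_cons, AffineWeyl.mul_apply, ih, refl_simpleRoot_castVec, List.foldr_cons]

theorem w₁_eq_word : w₁ = word [1, 3, 4, 2, 3, 0, 2, 1, 3, 4, 5, 6] := by
  simp only [w₁, word, List.map, List.prod_cons, List.prod_nil, mul_one, mul_assoc]
  rfl

theorem w₂_eq_word : w₂ = word [3, 2, 1, 3, 0, 2] := by
  simp only [w₂, word, List.map, List.prod_cons, List.prod_nil, mul_one, mul_assoc]
  rfl

/-- The word is reduced: prepending each letter `j` to the rest of the word moves the dominant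
regular coweight `(1, …, 1)` to the negative side of the wall of `αⱼ`. -/
def isReducedWord : List (Fin 7) → Bool
  | [] => true
  | j :: l => decide (List.foldr simpleAct 1 (j :: l) j ≤ 0) && isReducedWord l

/-- The lifting property applied along a reduced word `l`: if the test fails, the element sending
`(1, …, 1)` to `v` is not below the product of `l` in the Bruhat order. -/
def bruhatTest : (Fin 7 → ℤ) → List (Fin 7) → Bool
  | v, [] => v = 1
  | v, j :: l => bruhatTest (if 0 < v j then v else simpleAct j v) l

/-- A regular point of the base alcove close to `0`: as roots have height at most `17`, their values
on it are less than `1 / 2` in absolute value. -/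
noncomputable def basePoint : Fin 7 → ℝ := (36 : ℝ)⁻¹ • castVec 1

theorem root'_basePoint (r : Root) : rootSystem.root' r basePoint = (∑ i, r.1 i : ℤ) / 36 := by
  rw [basePoint, map_smul, root'_apply, castVec_dotProduct, dotProduct_one, smul_eq_mul,
    inv_mul_eq_div]

theorem apply_basePoint {a : (Fin 7 → ℝ) ≃ᵃ[ℝ] (Fin 7 → ℝ)}
    (ha : a ∈ AffineWeyl.linearWeyl rootSystem) {v : Fin 7 → ℤ} (hav : a (castVec 1) = castVec v) :
    a basePoint = (36 : ℝ)⁻¹ • castVec v := by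
  rw [basePoint, ← hav, AffineWeyl.apply_eq_linear_of_mem_linearWeyl ha, map_smul,
    ← AffineWeyl.apply_eq_linear_of_mem_linearWeyl ha]

theorem sameSide_basePoint_iff {a : (Fin 7 → ℝ) ≃ᵃ[ℝ] (Fin 7 → ℝ)}
    (ha : a ∈ AffineWeyl.linearWeyl rootSystem) {v : Fin 7 → ℤ} (hav : a (castVec 1) = castVec v)
    (j : Fin 7) : AffineWeyl.SameSide rootSystem (simpleRoot j) 0 basePoint (a basePoint) ↔
      0 < v j := by
  have hbase : basePoint j = (36 : ℝ)⁻¹ := by simp [basePoint, castVec]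
  rw [AffineWeyl.SameSide, AffineWeyl.affineRoot, AffineWeyl.affineRoot, root'_simpleRoot,
    root'_simpleRoot, apply_basePoint ha hav, hbase, Int.cast_zero, sub_zero, sub_zero,
    mul_pos_iff_of_pos_left (by norm_num), Pi.smul_apply, smul_eq_mul,
    mul_pos_iff_of_pos_left (by norm_num), castVec, Int.cast_pos]

theorem basePoint_mem_alcove : basePoint ∈ AffineWeyl.alcove rootSystem simpleRoot highestRoot := by
  have htop : ∑ i, highestRoot.1 i = 17 := by decide
  constructor
  · intro i
    rw [root'_simpleRoot]
    simp [basePoint, castVec]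
  · rw [root'_basePoint, htop]
    norm_num

theorem bruhatTest_of_ascentLE {a : (Fin 7 → ℝ) ≃ᵃ[ℝ] (Fin 7 → ℝ)}
    (ha : a ∈ AffineWeyl.linearWeyl rootSystem) {v : Fin 7 → ℤ} (hav : a (castVec 1) = castVec v)
    {l : List (Fin 7)} (hl : isReducedWord l)
    (h : AffineWeyl.AscentLE rootSystem basePoint a (word l)) : bruhatTest v l := by
  induction l generalizing a v with
  | nil =>
    obtain rfl := h.eq_one
    exact decide_eq_true (castVec_injective hav.symm)
  | cons j l ih =>
    rw [isReducedWord, Bool.and_eq_true, decide_eq_true_iff] at hl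
    have hside : ¬ AffineWeyl.SameSide rootSystem (simpleRoot j) 0 basePoint
        (word (j :: l) basePoint) := by
      rw [sameSide_basePoint_iff (word_mem_linearWeyl _) (word_castVec _ _)]
      exact hl.1.not_gt
    have hlift := AffineWeyl.AscentLE.lifting isBaseWithHighestRoot basePoint_mem_alcove
      (.inl ⟨j, (AffineWeyl.affRefl_zero _).symm⟩) (AffineWeyl.linearWeyl_le_extAffineWeyl ha) h
      hside
    have hcancel : AffineWeyl.affRefl rootSystem (simpleRoot j) 0 * word (j :: l) = word l := by
      rw [word_cons, ← AffineWeyl.affRefl_zero, ← mul_assoc, AffineWeyl.affRefl_mul_self, one_mul]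
    rw [hcancel, sameSide_basePoint_iff ha hav] at hlift
    rw [bruhatTest]
    split_ifs with hj
    · exact ih ha hav hl.2 (hlift.1 hj)
    · rw [AffineWeyl.affRefl_zero] at hlift
      refine ih (mul_mem (AffineWeyl.refl_mem_linearWeyl _) ha) ?_ hl.2 (hlift.2 hj)
      rw [AffineWeyl.mul_apply, hav, refl_simpleRoot_castVec]

theorem not_ascentLE_w₂_w₁ : ¬ AffineWeyl.AscentLE rootSystem basePoint w₂ w₁ := by
  intro h
  rw [w₁_eq_word, w₂_eq_word] at h
  have htest := bruhatTest_of_ascentLE (word_mem_linearWeyl _) (word_castVec _ _) (by decide) h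
  revert htest
  decide

theorem sum_pos_of_nonneg (r : Root) (hr : 0 ≤ r.1) : 0 < ∑ i, r.1 i := by
  refine (Finset.sum_nonneg fun i _ => hr i).lt_of_ne' fun hsum => ?_
  have hzero : r.1 = 0 := funext fun i =>
    (Finset.sum_eq_zero_iff_of_nonneg fun i _ => hr i).1 hsum i (Finset.mem_univ i)
  have hform := r.2.form_self
  rw [hzero] at hform
  exact absurd hform (by decide)

theorem root'_basePoint_ne_zero_and_abs_lt (r : Root) :
    rootSystem.root' r basePoint ≠ 0 ∧ |rootSystem.root' r basePoint| < 1 / 2 := by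
  have hle {r : Fin 7 → ℤ} (hr : r ≤ highestRoot.1) : ∑ i, r i ≤ 17 :=
    (Finset.sum_le_sum fun i _ => hr i).trans_eq (by decide)
  have hheight : ∑ i, r.1 i ≠ 0 ∧ |∑ i, r.1 i| ≤ 17 := by
    obtain ⟨h0, h1⟩ | ⟨h0, h1⟩ := r.2.mem_Icc_or_neg_mem_Icc
    · have hpos := sum_pos_of_nonneg r h0
      exact ⟨hpos.ne', (abs_of_pos hpos).trans_le (hle h1)⟩
    · have hpos := sum_pos_of_nonneg ⟨-r.1, r.2.neg⟩ h0
      have hle17 := hle h1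
      simp only [Pi.neg_apply, Finset.sum_neg_distrib] at hpos hle17
      exact ⟨(neg_pos.1 hpos).ne, (abs_of_neg (neg_pos.1 hpos)).trans_le hle17⟩
  have habs : |(∑ i, r.1 i : ℤ)| ≤ (17 : ℝ) := by exact_mod_cast hheight.2
  rw [root'_basePoint, abs_div, abs_of_pos (by norm_num : (0 : ℝ) < 36)]
  refine ⟨div_ne_zero (Int.cast_ne_zero.2 hheight.1) (by norm_num), ?_⟩
  rw [← Int.cast_abs]
  linarith

theorem root'_basePoint_mul_root'_rho7_nonneg (r : Root) :
    0 ≤ rootSystem.root' r basePoint * rootSystem.root' r rho7 := by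
  rw [root'_basePoint, root'_rho7, div_mul_eq_mul_div]
  refine div_nonneg ?_ (by norm_num)
  norm_cast
  obtain ⟨h, -⟩ | ⟨h, -⟩ := r.2.mem_Icc_or_neg_mem_Icc
  · exact mul_nonneg (Finset.sum_nonneg fun i _ => h i) (h 6)
  · exact mul_nonneg_of_nonpos_of_nonpos
      (Finset.sum_nonpos fun i _ => neg_nonneg.1 (h i)) (neg_nonneg.1 (h 6))

theorem x_notMem_Adm : x ∉ Adm rho7 := by
  rintro ⟨-, w, hw, hle⟩
  have hmem₁ : w₁ ∈ AffineWeyl.linearWeyl rootSystem := w₁_eq_word ▸ word_mem_linearWeyl _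
  have hmem₂ : w₂ ∈ AffineWeyl.linearWeyl rootSystem := w₂_eq_word ▸ word_mem_linearWeyl _
  exact not_ascentLE_w₂_w₁ <| AffineWeyl.AscentLE.of_mul_trans_mul_inv isMinuscule_rho7
    (isMinuscule_rho7.map hw) root'_basePoint_ne_zero_and_abs_lt
    root'_basePoint_mul_root'_rho7_nonneg hmem₂ hmem₁
    (hle.ascentLE isBaseWithHighestRoot basePoint_mem_alcove)

/-! ### Permissibility of `x` -/

theorem word_inv (l : List (Fin 7)) : (word l)⁻¹ = word l.reverse := by
  have hinv (j : Fin 7) : (AffineWeyl.refl rootSystem (simpleRoot j))⁻¹ =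
      AffineWeyl.refl rootSystem (simpleRoot j) := by
    rw [← AffineWeyl.affRefl_zero, AffineWeyl.affRefl_inv]
  rw [word, word, List.prod_inv_reverse, List.map_map, List.map_reverse]
  simp only [Function.comp_def, hinv]

theorem word_append (l l' : List (Fin 7)) : word (l ++ l') = word l * word l' := by
  rw [word, List.map_append, List.prod_append, word, word]

theorem castVec_single (i : Fin 7) : castVec (Pi.single i 1) = Pi.single i 1 := by
  funext j
  simp [castVec, Pi.single_apply]

theorem word_apply (l : List (Fin 7)) (v : Fin 7 → ℝ) :
    word l v = ∑ i, v i • castVec (l.foldr simpleAct (Pi.single i 1)) := by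
  have hlin := AffineWeyl.apply_eq_linear_of_mem_linearWeyl (word_mem_linearWeyl l)
  conv_lhs => rw [hlin, pi_eq_sum_univ' v, map_sum]
  refine Finset.sum_congr rfl fun i _ => ?_
  rw [map_smul, ← hlin, ← castVec_single, word_castVec]

theorem castVec_mem_orbit_rho7 (l : List (Fin 7)) :
    castVec (l.foldr simpleAct (Pi.single 6 1)) ∈ AffineWeyl.orbit rootSystem rho7 := by
  rw [← word_castVec, castVec_single]
  exact AffineWeyl.apply_mem_orbit_of_mem_linearWeyl (word_mem_linearWeyl l) rho7

theorem trans_rho7_mul_word_apply {l : List (Fin 7)} {M : Fin 7 → Fin 7 → ℤ}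
    (hM : ∀ i, l.foldr simpleAct (Pi.single i 1) = M i) (v : Fin 7 → ℝ) (j : Fin 7) :
    (AffineWeyl.trans rho7 * word l) v j = rho7 j + ∑ i, v i * M i j := by
  rw [AffineWeyl.mul_apply, AffineWeyl.trans_apply, word_apply, Pi.add_apply, Finset.sum_apply]
  simp only [hM]
  rfl

theorem trans_rho7_mul_word_mem_extAffineWeyl (l : List (Fin 7)) :
    AffineWeyl.trans rho7 * word l ∈ AffineWeyl.extAffineWeyl rootSystem :=
  mul_mem (AffineWeyl.trans_mem_extAffineWeyl isMinuscule_rho7.mem_coweightLattice)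
    (AffineWeyl.linearWeyl_le_extAffineWeyl (word_mem_linearWeyl l))

/-- The nontrivial element of `Ω`; its linear part is the quotient of the longest element of `W` by
that of the parabolic subgroup of type `E₆`. -/
noncomputable def omega : (Fin 7 → ℝ) ≃ᵃ[ℝ] (Fin 7 → ℝ) :=
  AffineWeyl.trans rho7 *
    word [6, 5, 4, 3, 2, 1, 3, 4, 5, 6, 0, 2, 3, 4, 5, 1, 3, 4, 2, 3, 1, 0, 2, 3, 4, 5, 6]

theorem trans_rho7_mul_word_mul_omega_inv_mem_affineWeyl (l : List (Fin 7)) :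
    AffineWeyl.trans rho7 * word l * omega⁻¹ ∈ AffineWeyl.affineWeyl rootSystem := by
  refine AffineWeyl.mul_inv_mem_affineWeyl (trans_rho7_mul_word_mem_extAffineWeyl l)
    (trans_rho7_mul_word_mem_extAffineWeyl _) ?_
  simp only [omega, AffineWeyl.mul_apply,
    AffineWeyl.apply_zero_of_mem_linearWeyl (word_mem_linearWeyl _), sub_self, zero_mem]

theorem root'_highestRoot (v : Fin 7 → ℝ) : rootSystem.root' highestRoot v =
    2 * v 0 + 2 * v 1 + 3 * v 2 + 4 * v 3 + 3 * v 4 + 2 * v 5 + v 6 := by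
  rw [root'_apply]
  simp [castVec, highestRoot, dotProduct, Fin.sum_univ_succ]
  ring

theorem omega_apply (v : Fin 7 → ℝ) :
    omega v = ![v 5, v 1, v 4, v 3, v 2, v 0, 1 - rootSystem.root' highestRoot v] := by
  funext j
  rw [omega, trans_rho7_mul_word_apply (M := ![![0, 0, 0, 0, 0, 1, -2], ![0, 1, 0, 0, 0, 0, -2],
    ![0, 0, 0, 0, 1, 0, -3], ![0, 0, 0, 1, 0, 0, -4], ![0, 0, 1, 0, 0, 0, -3],
    ![1, 0, 0, 0, 0, 0, -2], ![0, 0, 0, 0, 0, 0, -1]]) (by decide +kernel), root'_highestRoot]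
  fin_cases j <;> simp [rho7, Fin.sum_univ_succ]
  ring

theorem omega_omega (v : Fin 7 → ℝ) : omega (omega v) = v := by
  funext j
  rw [omega_apply, omega_apply, root'_highestRoot, root'_highestRoot]
  fin_cases j <;> simp
  ring

theorem omega_mem_alcove {v : Fin 7 → ℝ}
    (hv : v ∈ AffineWeyl.alcove rootSystem simpleRoot highestRoot) :
    omega v ∈ AffineWeyl.alcove rootSystem simpleRoot highestRoot := by
  have hcoord (i : Fin 7) : 0 < v i := root'_simpleRoot i v ▸ hv.1 i
  constructor
  · intro i
    rw [root'_simpleRoot, omega_apply]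
    fin_cases i
    exacts [hcoord 5, hcoord 1, hcoord 4, hcoord 3, hcoord 2, hcoord 0, sub_pos.2 hv.2]
  · have hfix := congrFun (omega_omega v) 6
    rw [omega_apply (omega v)] at hfix
    exact sub_pos.1 ((hcoord 6).trans_eq hfix.symm)

theorem omega_mem_Omega : omega ∈ AffineWeyl.Omega rootSystem simpleRoot highestRoot := by
  refine ⟨trans_rho7_mul_word_mem_extAffineWeyl _, Set.Subset.antisymm ?_ fun v hv => ?_⟩
  · rintro _ ⟨v, hv, rfl⟩
    exact omega_mem_alcove hv
  · exact ⟨omega v, omega_mem_alcove hv, omega_omega v⟩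

theorem x_eq_trans_rho7_mul_word : x = AffineWeyl.trans rho7 *
    word ([3, 2, 1, 3, 0, 2] ++ [1, 3, 4, 2, 3, 0, 2, 1, 3, 4, 5, 6].reverse) := by
  have hfix : word [3, 2, 1, 3, 0, 2] rho7 = rho7 := by
    rw [rho7, ← castVec_single, word_castVec]
    exact congrArg castVec (by decide)
  rw [x, w₁_eq_word, w₂_eq_word, AffineWeyl.mul_trans_of_mem_linearWeyl (word_mem_linearWeyl _),
    hfix, mul_assoc, word_inv, word_append]

theorem x_apply (v : Fin 7 → ℝ) : x v =
    ![v 2, v 4, v 0, -v 0 - v 2 - v 3 - v 4, v 0 + v 1 + 2 * v 2 + 3 * v 3 + 2 * v 4 + v 5, v 6,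
      1 - v 0 - 2 * v 1 - 2 * v 2 - 3 * v 3 - 2 * v 4 - v 5 - v 6] := by
  funext j
  rw [x_eq_trans_rho7_mul_word, trans_rho7_mul_word_apply
    (M := ![![0, 0, 1, -1, 1, 0, -1], ![0, 0, 0, 0, 1, 0, -2], ![1, 0, 0, -1, 2, 0, -2],
    ![0, 0, 0, -1, 3, 0, -3], ![0, 1, 0, -1, 2, 0, -2],
    ![0, 0, 0, 0, 1, 0, -1], ![0, 0, 0, 0, 0, 1, -1]]) (by decide)]
  fin_cases j <;> simp [rho7, Fin.sum_univ_succ] <;> ring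

theorem nonneg_and_root'_highestRoot_le_one_of_mem_closure_alcove {v : Fin 7 → ℝ}
    (hv : v ∈ closure (AffineWeyl.alcove rootSystem simpleRoot highestRoot)) :
    0 ≤ v ∧ rootSystem.root' highestRoot v ≤ 1 := by
  have hclosed : IsClosed {v : Fin 7 → ℝ | 0 ≤ v ∧ rootSystem.root' highestRoot v ≤ 1} := by
    simp only [root'_highestRoot, Set.ofPred_and]
    exact isClosed_Ici.inter (isClosed_le (by fun_prop) continuous_const)
  refine closure_minimal (fun u hu => ?_) hclosed hv
  refine ⟨fun i => ?_, hu.2.le⟩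
  exact root'_simpleRoot i u ▸ (hu.1 i).le

/-- Words `l` such that `x v - v` is the convex combination of the points `l ρ₇` with coefficients
`hullCoeff v`, for all `v` in the closed base alcove. -/
def hullWord : Fin 8 → List (Fin 7) :=
  ![[], [3, 0, 1, 2, 3, 4, 5, 6], [0, 1, 2, 3, 4, 5, 6], [3, 1, 2, 3, 4, 5, 6],
    [2, 3, 0, 1, 2, 3, 4, 5, 6], [2, 3, 4, 5, 6], [5, 6], [6]]

/-- The coefficients of `x v - v` with respect to the points given by `hullWord`. -/
def hullCoeff (v : Fin 7 → ℝ) : Fin 8 → ℝ :=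
  ![1 - v 0 - 2 * v 1 - 2 * v 2 - 3 * v 3 - 2 * v 4 - v 5 - v 6, v 0 + v 3 + v 4, v 1,
    v 1 + v 2 + v 3, v 2 + v 3, v 4, v 5, v 6]

theorem x_sub_self_eq_sum (v : Fin 7 → ℝ) : x v - v =
    ∑ k, hullCoeff v k • castVec ((hullWord k).foldr simpleAct (Pi.single 6 1)) := by
  have hpoint : ∀ k, (hullWord k).foldr simpleAct (Pi.single 6 1) =
    ![![0, 0, 0, 0, 0, 0, 1], ![-1, 0, 1, -1, 1, 0, 0], ![-1, -1, 0, 1, 0, 0, 0],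
      ![1, 0, 0, -1, 1, 0, 0], ![0, 0, -1, 0, 1, 0, 0], ![1, 1, -1, 0, 0, 0, 0],
      ![0, 0, 0, 0, 1, -1, 0], ![0, 0, 0, 0, 0, 1, -1]] k := by decide
  funext j
  simp only [hpoint]
  rw [x_apply, Finset.sum_apply]
  fin_cases j <;> simp [Fin.sum_univ_succ, hullCoeff, castVec] <;> ring

theorem hullCoeff_nonneg {v : Fin 7 → ℝ} (hv : 0 ≤ v) (hθ : rootSystem.root' highestRoot v ≤ 1)
    (k : Fin 8) : 0 ≤ hullCoeff v k := by
  have hcoord (i : Fin 7) : 0 ≤ v i := hv i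
  fin_cases k
  · change 0 ≤ 1 - v 0 - 2 * v 1 - 2 * v 2 - 3 * v 3 - 2 * v 4 - v 5 - v 6
    rw [root'_highestRoot] at hθ
    linarith [hcoord 0, hcoord 2, hcoord 3, hcoord 4, hcoord 5]
  exacts [add_nonneg (add_nonneg (hcoord 0) (hcoord 3)) (hcoord 4), hcoord 1,
    add_nonneg (add_nonneg (hcoord 1) (hcoord 2)) (hcoord 3), add_nonneg (hcoord 2) (hcoord 3),
    hcoord 4, hcoord 5, hcoord 6]

theorem x_sub_self_mem_convexHull {v : Fin 7 → ℝ}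
    (hv : v ∈ closure (AffineWeyl.alcove rootSystem simpleRoot highestRoot)) :
    x v - v ∈ convexHull ℝ (AffineWeyl.orbit rootSystem rho7) := by
  obtain ⟨hpos, hθ⟩ := nonneg_and_root'_highestRoot_le_one_of_mem_closure_alcove hv
  have hsum : ∑ k, hullCoeff v k = 1 := by
    simp [Fin.sum_univ_succ, hullCoeff]
    ring
  rw [x_sub_self_eq_sum]
  exact (convex_convexHull ℝ _).sum_mem (fun k _ => hullCoeff_nonneg hpos hθ k) hsum
    fun k _ => subset_convexHull ℝ _ (castVec_mem_orbit_rho7 _)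

theorem x_mem_Perm : x ∈ Perm rho7 := by
  have hx := x_eq_trans_rho7_mul_word
  have hhull := fun v => x_sub_self_mem_convexHull (v := v)
  generalize x = g at hx hhull ⊢
  subst hx
  exact ⟨trans_rho7_mul_word_mem_extAffineWeyl _, ⟨omega, omega_mem_Omega, _,
    trans_rho7_mul_word_mul_omega_inv_mem_affineWeyl _, _,
    trans_rho7_mul_word_mul_omega_inv_mem_affineWeyl [], (inv_mul_cancel_right _ _).symm,
    (inv_mul_cancel_right _ _).symm⟩, hhull⟩

theorem Adm_ne_Perm {μ : Fin 7 → ℝ} (hμ : AffineWeyl.IsMinuscule rootSystem μ) (hμ0 : μ ≠ 0) :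
    Adm μ ≠ Perm μ := by
  obtain ⟨w, hw, hwμ⟩ := exists_map_eq_rho7 hμ hμ0
  intro h
  have hμw : w⁻¹ rho7 = μ := by
    rw [← hwμ]
    exact w.symm_apply_apply μ
  have hx : x ∈ Perm μ := hμw ▸ AffineWeyl.Perm_subset_Perm_map (inv_mem hw)
    isMinuscule_rho7.mem_coweightLattice x_mem_Perm
  have hAdm : Adm μ = Adm rho7 :=
    AffineWeyl.Adm_eq_of_orbit_eq (hwμ ▸ (AffineWeyl.orbit_map hw μ).symm)
  exact x_notMem_Adm (hAdm ▸ h ▸ hx)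

end E7

theorem mainTheorem2 :
    (∀ μ : Fin 7 → ℝ,
      (μ ∈ AffineWeyl.coweightLattice E7.rootSystem ∧
        AffineWeyl.IsMinuscule E7.rootSystem μ ∧
        AffineWeyl.IsDominant E7.rootSystem E7.simpleRoot μ ∧ μ ≠ 0) ↔ μ = E7.rho7) ∧
    E7.x ∈ E7.Perm E7.rho7 ∧
    E7.x ∉ E7.Adm E7.rho7 ∧
    ∀ μ ∈ AffineWeyl.coweightLattice E7.rootSystem,
      AffineWeyl.IsMinuscule E7.rootSystem μ → μ ≠ 0 → E7.Adm μ ≠ E7.Perm μ :=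
  ⟨E7.mem_coweightLattice_and_isMinuscule_and_isDominant_iff, E7.x_mem_Perm, E7.x_notMem_Adm,
    fun _ _ hμ hμ0 => E7.Adm_ne_Perm hμ hμ0⟩
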